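/- Let $G$ be a compact Hausdorff group with identity $e$ and normalized Haar measure $m_G$, and let $L^p(G)$ be the complex Lebesgue space with respect to $m_G$, with norm $\|\cdot\|_p$. Let $\widehat G$ be the set of irreducible (strongly continuous) unitary representations $\pi$ of $G$ on complex Hilbert spaces $\mathcal H_\pi$, up to unitary equivalence; each $\mathcal H_\pi$ is finite-dimensional, of dimension $d_\pi$. For $1\le q<\infty$ and a bounded operator $T$ on $\mathcal H_\pi$ put $\|T\|_{\mathcal B_q(\mathcal H_\pi)}=(\operatorname{tr}|T|^q)^{1/q}$, and let $\|T\|_{\mathcal B_\infty(\mathcal H_\pi)}$ be the operator norm. For $\Lambda\subset\widehat G$ and a family $\phi=(\phi_\pi)_{\pi\in\widehat G}$ of operators $\phi_\pi$ on $\mathcal H_\pi$ put $$\|\phi\|_{q,\Lambda}=\Big(\sum_{\pi\in\Lambda}d_\pi\|\phi_\pi\|_{\mathcal B_q(\mathcal H_\pi)}^q\Big)^{1/q}\ (1\le q<\infty),\qquad \|\phi\|_{\infty,\Lambda}=\sup_{\pi\in\Lambda}\|\phi_\pi\|_{\mathcal B_\infty(\mathcal H_\pi)},$$ and let $\ell^q\text{-}\bigoplus_{\pi\in\widehat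 G}\mathcal B_q(\mathcal H_\pi)$ be the space of all $\phi$ with $\|\phi\|_{q,\widehat G}<\infty$. A subset $F$ of this space has uniform $\ell^q\text{-}\bigoplus_{\pi\in\widehat G}\mathcal B_q(\mathcal H_\pi)$-decay if for every $\varepsilon>0$ there is a finite set $A\subset\widehat G$ such that $\|\phi\|_{q,\widehat G\setminus A}<\varepsilon$ for all $\phi\in F$. For $f\in L^1(G)$ let $\widehat f(\pi)=\int_G f(t)\,\pi(t)^*\,dm_G(t)$, $\pi\in\widehat G$, and for $y\in G$ let $R_yf(x)=f(xy)$. A set $K\subset L^p(G)$ is uniformly $L^p(G)$-equicontinuous if for every $\varepsilon>0$ there is an open neighbourhood $O$ of $e$ such that $\|R_yf-f\|_p<\varepsilon$ for all $f\in K$ and $y\in O$. Let $p\in[1,2]$, let $p'$ be its conjugate exponent, $\frac1p+\frac1{p'}=1$ (so $p'=\infty$ if $p=1$), and let $K\subset L^p(G)$. If $K$ is uniformly $L^p(G)$-equicontinuous, then $\widehat K=\{\widehat f:f\in K\}$ is a subset of $\ell^{p'}\text{-}\bigoplus_{\pi\in\widehat G}\mathcal B_{p'}(\mathcal H_\pi)$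 and has uniform $\ell^{p'}\text{-}\bigoplus_{\pi\in\widehat G}\mathcal B_{p'}(\mathcal H_\pi)$-decay. -/

import Mathlib

open MeasureTheory TopologicalSpace
open scoped ENNReal

universe u v

noncomputable section

/-- The normalized Haar measure `m_G` of a compact group. -/
def normalizedHaar (G : Type u) [Group G] [TopologicalSpace G] [IsTopologicalGroup G]
    [CompactSpace G] [MeasurableSpace G] [BorelSpace G] : Measure G :=
  Measure.haarMeasure (⊤ : PositiveCompacts G)

/-- An irreducible unitary representation of `G`: a strongly continuous homomorphism into the
unitary group of a nonzero complex Hilbert space without nontrivial closed invariant subspaces. -/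
structure UnitaryIrrep (G : Type u) [Group G] [TopologicalSpace G] where
  /-- The representation space. -/
  H : Type v
  [normedAddCommGroup : NormedAddCommGroup H]
  [innerProductSpace : InnerProductSpace ℂ H]
  [completeSpace : CompleteSpace H]
  [nontrivial : Nontrivial H]
  /-- The action. -/
  ρ : G →* unitary (H →L[ℂ] H)
  continuous_apply : ∀ x : H, Continuous fun g : G => (ρ g : H →L[ℂ] H) x
  irreducible : ∀ V : Submodule ℂ H, IsClosed (V : Set H) →
    (∀ g : G, ∀ x ∈ V, (ρ g : H →L[ℂ] H) x ∈ V) → V = ⊥ ∨ V = ⊤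

attribute [instance] UnitaryIrrep.normedAddCommGroup UnitaryIrrep.innerProductSpace
  UnitaryIrrep.completeSpace UnitaryIrrep.nontrivial

/-- Unitary equivalence of irreducible unitary representations. -/
instance UnitaryIrrep.setoid (G : Type u) [Group G] [TopologicalSpace G] :
    Setoid (UnitaryIrrep.{u, v} G) where
  r π σ := ∃ U : π.H ≃ₗᵢ[ℂ] σ.H, ∀ (g : G) (x : π.H),
    U ((π.ρ g : π.H →L[ℂ] π.H) x) = (σ.ρ g : σ.H →L[ℂ] σ.H) (U x)
  iseqv :=
    { refl := fun π => ⟨LinearIsometryEquiv.refl ℂ π.H, fun _ _ => rfl⟩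
      symm := fun {π σ} ⟨U, hU⟩ => ⟨U.symm, fun g x => by
        apply U.injective
        rw [hU, U.apply_symm_apply, U.apply_symm_apply]⟩
      trans := fun {π σ τ} ⟨U, hU⟩ ⟨W, hW⟩ => ⟨U.trans W, fun g x => by
        simp only [LinearIsometryEquiv.trans_apply, hU, hW]⟩ }

/-- The unitary dual: irreducible unitary representations up to unitary equivalence. -/
def UnitaryDual (G : Type u) [Group G] [TopologicalSpace G] : Type (max u (v + 1)) :=
  Quotient (UnitaryIrrep.setoid.{u, v} G)

namespace UnitaryDual

variable {G : Type u} [Group G] [TopologicalSpace G]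

/-- A representative of the class `π`. -/
def rep (π : UnitaryDual.{u, v} G) : UnitaryIrrep.{u, v} G := Quotient.out π

/-- The representation space `H_π`. -/
abbrev space (π : UnitaryDual.{u, v} G) : Type v := π.rep.H

/-- The dimension `d_π` of `H_π` (finite when `G` is compact). -/
def dim (π : UnitaryDual.{u, v} G) : ℕ := Module.finrank ℂ π.space

end UnitaryDual

/-- The trace of a positive operator, `∑ ⟪b i, S (b i)⟫` over a Hilbert basis `b`. -/
def posTrace {H : Type v} [NormedAddCommGroup H] [InnerProductSpace ℂ H] [CompleteSpace H]
    (S : H →L[ℂ] H) : ℝ≥0∞ :=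
  ∑' x : (exists_hilbertBasis ℂ H).choose,
    ENNReal.ofReal (RCLike.re (inner ℂ (x : H) (S (x : H))))

/-- The norm of `B_q(H)`: `(tr |T|^q)^(1/q)` for `q < ∞`, and the operator norm for `q = ∞`. -/
def schattenNorm {H : Type v} [NormedAddCommGroup H] [InnerProductSpace ℂ H] [CompleteSpace H]
    (q : ℝ≥0∞) (T : H →L[ℂ] H) : ℝ≥0∞ :=
  open Classical in
  if q = ∞ then ‖T‖ₑ else posTrace (CFC.abs T ^ q.toReal) ^ (1 / q.toReal)

/-- The norm of `ℓ^q-⊕_{π ∈ Λ} B_q(H_π)`, with value `∞` outside of this space. -/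
def dualNorm {G : Type u} [Group G] [TopologicalSpace G] (q : ℝ≥0∞)
    (Λ : Set (UnitaryDual.{u, v} G))
    (φ : ∀ π : UnitaryDual.{u, v} G, π.space →L[ℂ] π.space) : ℝ≥0∞ :=
  open Classical in
  if q = ∞ then ⨆ π ∈ Λ, schattenNorm q (φ π)
  else (∑' π : Λ, (π.1.dim : ℝ≥0∞) * schattenNorm q (φ π.1) ^ q.toReal) ^ (1 / q.toReal)

/-- `F` is a subset of `ℓ^q-⊕ B_q(H_π)` with uniform `ℓ^q-⊕ B_q(H_π)`-decay. -/
def HasUniformDecay {G : Type u} [Group G] [TopologicalSpace G] (q : ℝ≥0∞)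
    (F : Set (∀ π : UnitaryDual.{u, v} G, π.space →L[ℂ] π.space)) : Prop :=
  (∀ φ ∈ F, dualNorm q Set.univ φ < ∞) ∧
  ∀ ε : ℝ, 0 < ε → ∃ A : Set (UnitaryDual.{u, v} G), A.Finite ∧
    ∀ φ ∈ F, dualNorm q Aᶜ φ < ENNReal.ofReal ε

section Fourier

variable {G : Type u} [Group G] [TopologicalSpace G] [IsTopologicalGroup G]
  [CompactSpace G] [MeasurableSpace G] [BorelSpace G]

/-- The Fourier transform `f̂(π) = ∫ f(t) π(t)^* dm_G(t)`. -/
def fourierTransform (f : G → ℂ) (π : UnitaryDual.{u, v} G) : π.space →L[ℂ] π.space :=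
  ∫ t, f t • star (π.rep.ρ t : π.space →L[ℂ] π.space) ∂(normalizedHaar G)

/-- `K̂ = {f̂ : f ∈ K}`. -/
def fourierImage {p : ℝ≥0∞} (K : Set (Lp ℂ p (normalizedHaar G))) :
    Set (∀ π : UnitaryDual.{u, v} G, π.space →L[ℂ] π.space) :=
  (fun f : Lp ℂ p (normalizedHaar G) => fourierTransform.{u, v} (f : G → ℂ)) '' K

/-- Uniform `L^p(G)`-equicontinuity: `‖R_y f - f‖_p < ε` for `f ∈ K` and `y` near `e`, where
`R_y f (x) = f (x y)`. -/
def UniformlyLpEquicontinuous {p : ℝ≥0∞} (K : Set (Lp ℂ p (normalizedHaar G))) : Prop :=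
  ∀ ε : ℝ, 0 < ε → ∃ O : Set G, IsOpen O ∧ 1 ∈ O ∧ ∀ f ∈ K, ∀ y ∈ O,
    eLpNorm (fun x => f (x * y) - f x) p (normalizedHaar G) < ENNReal.ofReal ε

end Fourier

end

/-! The Fourier coefficient of $R_yf-f$ at $\pi$ is $(\pi(y)-1)\widehat f(\pi)$. Average it over
$y\in O$ for a neighbourhood $O$ given by equicontinuity. The average of $\pi$ over $O$ is the
adjoint of $\widehat h(\pi)$ with $h=1_O/m_G(O)\in L^2$, so Bessel's inequality makes its numerical
radius at most $1/2$ off a finite set of $\pi$ that depends on $O$ only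
(`finite_setOf_not_average_le`). There $\pi(y)-1$ is bounded below on average, and $\widehat f(\pi)$
is controlled by the averaged coefficients of $R_yf-f$ (`norm_fourierTransform_apply_le_average`).

For $p=1$ the bound $\|\widehat g(\pi)\|\le\|g\|_1$ finishes. For $p>1$ Jensen moves the power $p'$
inside the average, and a Hausdorff–Young inequality is applied to each $R_yf-f$. No interpolation
of Schatten classes is needed: in an eigenbasis $e$ of $|\widehat f(\pi)|$ the Schatten norm is
$\sum_i\|\widehat f(\pi)e_i\|^{p'}$, and each summand is a scalar coefficient $\langle a_i,\widehat
f(\pi)e_i\rangle$ with $\|a_i\|\le1$. With $a,e$ frozen these depend linearly on the function, so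
scalar Marcinkiewicz interpolation between $L^1\to\ell^\infty$ and $L^2\to\ell^2$ suffices; its
constant 2 is harmless. -/

/-! ### Normalized Haar measure -/

section Haar

variable {G : Type u} [Group G] [TopologicalSpace G] [IsTopologicalGroup G]
  [CompactSpace G] [MeasurableSpace G] [BorelSpace G]

instance normalizedHaar_isHaarMeasure : (normalizedHaar G).IsHaarMeasure := by
  unfold normalizedHaar; infer_instance

instance normalizedHaar_isProbabilityMeasure : IsProbabilityMeasure (normalizedHaar G) :=
  ⟨by simpa [normalizedHaar] using Measure.haarMeasure_self (K₀ := (⊤ : PositiveCompacts G))⟩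

/-- A right translate of Haar measure is again a Haar probability measure, and there is only one. -/
instance normalizedHaar_isMulRightInvariant : (normalizedHaar G).IsMulRightInvariant where
  map_mul_right_eq_self g := by
    have : IsProbabilityMeasure ((normalizedHaar G).map (· * g)) :=
      Measure.isProbabilityMeasure_map (measurable_mul_const g).aemeasurable
    exact Measure.isHaarMeasure_eq_of_isProbabilityMeasure _ _

theorem Continuous.integrable_normalizedHaar {E : Type*} [NormedAddCommGroup E] {f : G → E}
    (hf : Continuous f) : Integrable f (normalizedHaar G) :=
  hf.integrable_of_hasCompactSupport (HasCompactSupport.of_compactSpace f)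

end Haar

/-! ### Schur's lemma and finite-dimensionality -/

namespace UnitaryIrrep

section Action

variable {G : Type u} [Group G] [TopologicalSpace G] (π σ : UnitaryIrrep.{u, v} G)

theorem ρ_mul_apply (g h : G) (x : π.H) :
    (π.ρ (g * h) : π.H →L[ℂ] π.H) x = (π.ρ g : π.H →L[ℂ] π.H) ((π.ρ h : π.H →L[ℂ] π.H) x) := by
  rw [map_mul]; rfl

theorem ρ_one_apply (x : π.H) : (π.ρ 1 : π.H →L[ℂ] π.H) x = x := by
  rw [map_one]; rfl

theorem adjoint_ρ (g : G) :
    ContinuousLinearMap.adjoint (π.ρ g : π.H →L[ℂ] π.H) = (π.ρ g⁻¹ : π.H →L[ℂ] π.H) := by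
  rw [map_inv, ← ContinuousLinearMap.star_eq_adjoint, ← Unitary.coe_star]; rfl

theorem inner_ρ_left (g : G) (x y : π.H) :
    inner ℂ ((π.ρ g : π.H →L[ℂ] π.H) x) y = inner ℂ x ((π.ρ g⁻¹ : π.H →L[ℂ] π.H) y) := by
  rw [← adjoint_ρ, ContinuousLinearMap.adjoint_inner_right]

theorem inner_ρ_ρ (g : G) (x y : π.H) :
    inner ℂ ((π.ρ g : π.H →L[ℂ] π.H) x) ((π.ρ g : π.H →L[ℂ] π.H) y) = inner ℂ x y := by
  rw [inner_ρ_left, ← ρ_mul_apply, inv_mul_cancel, ρ_one_apply]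

theorem norm_ρ_apply (g : G) (x : π.H) : ‖(π.ρ g : π.H →L[ℂ] π.H) x‖ = ‖x‖ := by
  rw [norm_eq_sqrt_re_inner (𝕜 := ℂ), inner_ρ_ρ, ← norm_eq_sqrt_re_inner (𝕜 := ℂ)]

theorem norm_ρ_le (g : G) : ‖(π.ρ g : π.H →L[ℂ] π.H)‖ ≤ 1 :=
  ContinuousLinearMap.opNorm_le_bound _ zero_le_one fun x => by rw [norm_ρ_apply, one_mul]

theorem continuous_rankOne_ρ (x : π.H) (w : σ.H) :
    Continuous fun t : G => InnerProductSpace.rankOne ℂ ((π.ρ t : π.H →L[ℂ] π.H) x)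
      ((σ.ρ t : σ.H →L[ℂ] σ.H) w) :=
  (ContinuousLinearMap.smulRightL ℂ σ.H π.H).continuous₂.comp
    (((innerSL ℂ).continuous.comp (σ.continuous_apply w)).prodMk (π.continuous_apply x))

variable {π σ}

/-- A bounded operator commuting with an irreducible representation is zero or injective. -/
theorem eq_zero_or_ker_eq_bot {F : Type*} [NormedAddCommGroup F] [NormedSpace ℂ F]
    (S : π.H →L[ℂ] F)
    (hS : ∀ g x, S x = 0 → S ((π.ρ g : π.H →L[ℂ] π.H) x) = 0) :
    S = 0 ∨ ∀ x, S x = 0 → x = 0 := by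
  rcases π.irreducible (LinearMap.ker (S : π.H →ₗ[ℂ] F)) S.isClosed_ker
    (fun g x hx => hS g x hx) with h | h
  · right
    intro x hx
    have : x ∈ LinearMap.ker (S : π.H →ₗ[ℂ] F) := hx
    rw [h] at this
    simpa using this
  · left
    ext x
    have : x ∈ LinearMap.ker (S : π.H →ₗ[ℂ] F) := h ▸ Submodule.mem_top
    exact this

/-- **Schur's lemma**: a self-adjoint operator commuting with an irreducible representation
is a scalar. -/
theorem exists_eq_smul_one_of_isSelfAdjoint (S : π.H →L[ℂ] π.H) (hsa : IsSelfAdjoint S)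
    (hS : ∀ g, Commute S (π.ρ g : π.H →L[ℂ] π.H)) :
    ∃ c : ℝ, S = (c : ℂ) • (1 : π.H →L[ℂ] π.H) := by
  have hne : (spectrum ℝ S).Nonempty := ContinuousFunctionalCalculus.spectrum_nonempty S hsa
  obtain ⟨a, ha⟩ := hne
  -- Bumps around two distinct spectral points have disjoint supports, so `cfc (f a) S * cfc (f b) S
  -- = 0`. The first factor commutes with the representation and is nonzero, hence injective, which
  -- kills the second. This works before finite-dimensionality is known.
  have huniq : ∀ b ∈ spectrum ℝ S, b = a := by
    intro b hb
    by_contra hba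
    have hd : 0 < dist a b := dist_pos.2 (Ne.symm hba)
    let f : ℝ → ℝ → ℝ := fun c x => max 0 (dist a b / 2 - dist x c)
    have hf : ∀ c, Continuous (f c) := fun c => by fun_prop
    have hmul : cfc (f a) S * cfc (f b) S = 0 := by
      rw [← cfc_mul (f a) (f b) S (hf a).continuousOn (hf b).continuousOn, ← cfc_zero ℝ S]
      congr 1
      ext x
      have htri := dist_triangle_left a b x
      rcases le_total (dist a b / 2) (dist x a) with h | h
      · simp [f, max_eq_left (sub_nonpos.2 h)]
      · have : dist a b / 2 ≤ dist x b := by linarith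
        simp [f, max_eq_left (sub_nonpos.2 this)]
    have hnz : ∀ c ∈ spectrum ℝ S, cfc (f c) S ≠ 0 := by
      intro c hc h0
      have : f c c ∈ spectrum ℝ (cfc (f c) S) := by
        rw [cfc_map_spectrum (f c) S hsa (hf c).continuousOn]
        exact ⟨c, hc, rfl⟩
      rw [h0, spectrum.zero_eq] at this
      have h1 : f c c = dist a b / 2 := by simp [f]; positivity
      rw [h1, Set.mem_singleton_iff] at this
      linarith
    have hinj := (eq_zero_or_ker_eq_bot (cfc (f a) S) (fun g x hx => by
      have := congrArg (fun T : π.H →L[ℂ] π.H => T x) ((hS g).cfc_real (f a)).eq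
      simp only [mul_apply_eq_comp] at this
      rw [this, hx, map_zero])).resolve_left (hnz a ha)
    apply hnz b hb
    ext x
    apply hinj
    exact congrArg (fun T : π.H →L[ℂ] π.H => T x) hmul
  refine ⟨a, ?_⟩
  conv_lhs => rw [← cfc_id ℝ S]
  rw [cfc_congr (f := id) (g := fun _ => a) (fun b hb => huniq b hb), cfc_const a S hsa]
  ext x
  simp [Algebra.algebraMap_eq_smul_one]

/-- A nonzero bounded intertwiner between irreducible representations makes them equivalent. -/
theorem equiv_of_intertwiner (T : σ.H →L[ℂ] π.H) (hT0 : T ≠ 0)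
    (hT : ∀ g x, T ((σ.ρ g : σ.H →L[ℂ] σ.H) x) = (π.ρ g : π.H →L[ℂ] π.H) (T x)) : σ ≈ π := by
  -- $T^*T=c$ with $c>0$, so $c^{-1/2}T$ is an isometry; its range is closed, invariant and nonzero.
  obtain ⟨c, hc⟩ := exists_eq_smul_one_of_isSelfAdjoint (π := σ)
    (ContinuousLinearMap.adjoint T ∘L T) (by
      rw [ContinuousLinearMap.isSelfAdjoint_iff']
      simp [ContinuousLinearMap.adjoint_comp]) (fun g => by
      ext x
      refine ext_inner_left ℂ fun y => ?_
      simp only [mul_apply_eq_comp, ContinuousLinearMap.comp_apply]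
      rw [ContinuousLinearMap.adjoint_inner_right, hT, ← inv_inv g, ← inner_ρ_left, ← inner_ρ_left,
        ContinuousLinearMap.adjoint_inner_right, hT])
  have hnorm : ∀ x, ‖T x‖ ^ 2 = c * ‖x‖ ^ 2 := by
    intro x
    have h1 := congrArg (fun S : σ.H →L[ℂ] σ.H => inner ℂ x (S x)) hc
    simp only [ContinuousLinearMap.comp_apply, ContinuousLinearMap.adjoint_inner_right,
      smul_apply, one_apply_eq_self, inner_smul_right,
      inner_self_eq_norm_sq_to_K, Complex.coe_algebraMap] at h1
    exact_mod_cast h1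
  obtain ⟨x₀, hx₀⟩ : ∃ x, T x ≠ 0 := by
    by_contra! h
    exact hT0 (by ext x; simpa using h x)
  have hcpos : 0 < c := by
    by_contra! h
    have h1 := hnorm x₀
    have h2 : 0 < ‖T x₀‖ ^ 2 := by positivity
    nlinarith [sq_nonneg ‖x₀‖]
  let r : ℂ := ((Real.sqrt c)⁻¹ : ℝ)
  have hrnorm : ∀ x, ‖(r • T) x‖ = ‖x‖ := by
    intro x
    have h1 : ‖T x‖ = Real.sqrt c * ‖x‖ := by
      rw [← Real.sqrt_sq (norm_nonneg (T x)), hnorm, Real.sqrt_mul hcpos.le,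
        Real.sqrt_sq (norm_nonneg x)]
    have h2 : 0 < Real.sqrt c := Real.sqrt_pos.2 hcpos
    rw [smul_apply, norm_smul, h1, Complex.norm_real, norm_inv, Real.norm_eq_abs,
      abs_of_pos h2]
    field_simp
  let L : σ.H →ₗᵢ[ℂ] π.H := ⟨(r • T : σ.H →L[ℂ] π.H), hrnorm⟩
  have hL : ∀ g x, L ((σ.ρ g : σ.H →L[ℂ] σ.H) x) = (π.ρ g : π.H →L[ℂ] π.H) (L x) := by
    intro g x
    change r • T _ = (π.ρ g : π.H →L[ℂ] π.H) (r • T x)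
    rw [hT, map_smul]
  have hrange : LinearMap.range L.toLinearMap = ⊤ := by
    refine (π.irreducible (LinearMap.range L.toLinearMap) ?_ ?_).resolve_left ?_
    · have := L.isometry.isClosedEmbedding.isClosed_range
      exact this
    · rintro g _ ⟨x, rfl⟩
      exact ⟨(σ.ρ g : σ.H →L[ℂ] σ.H) x, hL g x⟩
    · intro h
      have h1 : L x₀ ∈ LinearMap.range L.toLinearMap := ⟨x₀, rfl⟩
      rw [h, Submodule.mem_bot] at h1
      have h2 : x₀ = 0 := by rw [← norm_eq_zero, ← L.norm_map, h1, norm_zero]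
      exact hx₀ (by rw [h2, map_zero])
  exact ⟨LinearIsometryEquiv.ofSurjective L (LinearMap.range_eq_top.1 hrange), fun g x => hL g x⟩

end Action

section Average

variable {G : Type u} [Group G] [TopologicalSpace G] [IsTopologicalGroup G]
  [CompactSpace G] [MeasurableSpace G] [BorelSpace G] (π σ : UnitaryIrrep.{u, v} G)

/-- The Haar average of the rank one operators `y ↦ ⟪σ(t) w, y⟫ π(t) x`. -/
noncomputable def average (x : π.H) (w : σ.H) : σ.H →L[ℂ] π.H :=
  ∫ t, InnerProductSpace.rankOne ℂ ((π.ρ t : π.H →L[ℂ] π.H) x) ((σ.ρ t : σ.H →L[ℂ] σ.H) w)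
    ∂(normalizedHaar G)

theorem inner_average (x a : π.H) (w b : σ.H) :
    inner ℂ a (average π σ x w b) = ∫ t, inner ℂ ((σ.ρ t : σ.H →L[ℂ] σ.H) w) b *
      inner ℂ a ((π.ρ t : π.H →L[ℂ] π.H) x) ∂(normalizedHaar G) := by
  have hi := (continuous_rankOne_ρ π σ x w).integrable_normalizedHaar
  rw [average, ContinuousLinearMap.integral_apply hi,
    ← integral_inner (hi.apply_continuousLinearMap b)]
  simp [inner_smul_right]

theorem average_ρ_apply (x : π.H) (w b : σ.H) (g : G) :
    average π σ x w ((σ.ρ g : σ.H →L[ℂ] σ.H) b) =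
      (π.ρ g : π.H →L[ℂ] π.H) (average π σ x w b) := by
  refine ext_inner_left ℂ fun a => ?_
  rw [← inv_inv g, ← inner_ρ_left, inner_average, inner_average,
    ← integral_mul_left_eq_self _ g]
  congr 1
  ext t
  rw [inv_inv, ρ_mul_apply, ρ_mul_apply, inner_ρ_ρ, inner_ρ_left π, inv_inv]

theorem isSelfAdjoint_average (x : π.H) : IsSelfAdjoint (average π π x x) := by
  rw [ContinuousLinearMap.isSelfAdjoint_iff_isSymmetric]
  intro a b
  simp only [ContinuousLinearMap.coe_coe]
  rw [← inner_conj_symm, inner_average, inner_average, ← integral_conj]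
  congr 1
  ext t
  simp [mul_comm]

/-- The average of the rank one operators along the orbit of $x\ne0$ is a scalar $c>0$. Integrating
Bessel's inequality for $\pi(t)x$ against $n$ orthonormal vectors gives $cn\le\|x\|^2$, which bounds
$n$. -/
instance finiteDimensional : FiniteDimensional ℂ π.H := by
  obtain ⟨x, hx⟩ := exists_ne (0 : π.H)
  obtain ⟨c, hc⟩ := exists_eq_smul_one_of_isSelfAdjoint (average π π x x)
    (isSelfAdjoint_average π x) (fun g => by
      ext b; exact average_ρ_apply π π x x b g)
  have hinner : ∀ a : π.H, c * ‖a‖ ^ 2 =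
      ∫ t, ‖inner ℂ ((π.ρ t : π.H →L[ℂ] π.H) x) a‖ ^ 2 ∂(normalizedHaar G) := by
    intro a
    have h1 := inner_average π π x a x a
    have h2 : ∀ t, inner ℂ ((π.ρ t : π.H →L[ℂ] π.H) x) a * inner ℂ a ((π.ρ t : π.H →L[ℂ] π.H) x)
        = ((‖inner ℂ ((π.ρ t : π.H →L[ℂ] π.H) x) a‖ ^ 2 : ℝ) : ℂ) := by
      intro t
      rw [← inner_conj_symm a, RCLike.mul_conj]
      norm_cast
    simp_rw [h2] at h1
    rw [hc, integral_complex_ofReal] at h1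
    simp only [smul_apply, one_apply_eq_self, inner_smul_right,
      inner_self_eq_norm_sq_to_K, Complex.coe_algebraMap] at h1
    exact_mod_cast h1
  have hcont : ∀ a : π.H, Continuous fun t : G => ‖inner ℂ ((π.ρ t : π.H →L[ℂ] π.H) x) a‖ ^ 2 :=
    fun a => (((π.continuous_apply x).inner continuous_const).norm.pow 2)
  have hcpos : 0 < c := by
    have h1 := (hcont x).integral_pos_of_hasCompactSupport_nonneg_nonzero (μ := normalizedHaar G)
      (x := 1) (HasCompactSupport.of_compactSpace _) (fun t => by positivity) (by
        simp [hx])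
    rw [← hinner x] at h1
    by_contra! h
    nlinarith [sq_nonneg ‖x‖]
  obtain ⟨w, b, hb⟩ := exists_hilbertBasis ℂ π.H
  have hbound : ∀ s : Finset w, c * s.card ≤ ‖x‖ ^ 2 := by
    intro s
    have h1 : c * s.card = ∫ t, ∑ i ∈ s, ‖inner ℂ (b i) ((π.ρ t : π.H →L[ℂ] π.H) x)‖ ^ 2
        ∂(normalizedHaar G) := by
      rw [integral_finsetSum]
      · have : ∀ i ∈ s, ∫ t, ‖inner ℂ (b i) ((π.ρ t : π.H →L[ℂ] π.H) x)‖ ^ 2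
            ∂(normalizedHaar G) = c := by
          intro i _
          simp_rw [norm_inner_symm (b i)]
          rw [← hinner, b.orthonormal.1 i]
          simp
        rw [Finset.sum_congr rfl this]
        simp [mul_comm]
      · intro i _
        simp_rw [norm_inner_symm (b i)]
        exact (hcont (b i)).integrable_normalizedHaar
    rw [h1]
    calc _ ≤ ∫ _t : G, ‖x‖ ^ 2 ∂(normalizedHaar G) := by
          apply integral_mono_of_nonneg
          · exact Filter.Eventually.of_forall fun t => Finset.sum_nonneg fun i _ => by positivity
          · exact integrable_const _
          · refine Filter.Eventually.of_forall fun t => ?_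
            simpa [norm_ρ_apply] using b.orthonormal.sum_inner_products_le
              (x := (π.ρ t : π.H →L[ℂ] π.H) x) (s := s)
      _ = ‖x‖ ^ 2 := by simp
  have hfin : Finite w := by
    by_contra hinf
    rw [not_finite_iff_infinite] at hinf
    obtain ⟨n, hn⟩ := exists_nat_gt (‖x‖ ^ 2 / c)
    obtain ⟨s, hs⟩ := Infinite.exists_subset_card_eq w n
    have := hbound s
    rw [hs] at this
    rw [div_lt_iff₀ hcpos] at hn
    linarith
  have := Fintype.ofFinite w
  exact b.toOrthonormalBasis.toBasis.finiteDimensional_of_finite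

end Average

end UnitaryIrrep

/-! ### Schur orthogonality -/

namespace UnitaryIrrep

variable {G : Type u} [Group G] [TopologicalSpace G] [IsTopologicalGroup G]
  [CompactSpace G] [MeasurableSpace G] [BorelSpace G] (π σ : UnitaryIrrep.{u, v} G)

theorem integral_matrixCoeff_eq_zero (h : ¬ σ ≈ π) (x a : π.H) (w b : σ.H) :
    ∫ t, inner ℂ ((σ.ρ t : σ.H →L[ℂ] σ.H) w) b * inner ℂ a ((π.ρ t : π.H →L[ℂ] π.H) x)
      ∂(normalizedHaar G) = 0 := by
  have h0 : average π σ x w = 0 := by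
    by_contra hne
    exact h (equiv_of_intertwiner _ hne fun g y => average_ρ_apply π σ x w y g)
  rw [← inner_average, h0]
  simp

/-- In finite dimension an eigenvalue exists, so self-adjointness can be dropped. This is needed for
`average π π x w` with $w\ne x$. -/
theorem exists_eq_smul_one (S : π.H →L[ℂ] π.H)
    (hS : ∀ g, Commute S (π.ρ g : π.H →L[ℂ] π.H)) :
    ∃ c : ℂ, S = c • (1 : π.H →L[ℂ] π.H) := by
  obtain ⟨c, hc⟩ := Module.End.exists_eigenvalue (S : π.H →ₗ[ℂ] π.H)
  obtain ⟨y, hy, hy0⟩ := hc.exists_hasEigenvector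
  rw [Module.End.mem_eigenspace_iff] at hy
  refine ⟨c, sub_eq_zero.1 ((eq_zero_or_ker_eq_bot (S - c • (1 : π.H →L[ℂ] π.H)) ?_).resolve_right
    fun h => hy0 (h y ?_))⟩
  · intro g x hx
    have h1 := congrArg (fun T : π.H →L[ℂ] π.H => T x) (hS g).eq
    simp only [mul_apply_eq_comp] at h1
    have h2 : S x = c • x := sub_eq_zero.1 hx
    exact sub_eq_zero.2 (h1.trans (by rw [h2, map_smul]; rfl))
  · exact sub_eq_zero.2 hy

theorem integral_matrixCoeff (x a w b : π.H) :
    ∫ t, inner ℂ ((π.ρ t : π.H →L[ℂ] π.H) w) b * inner ℂ a ((π.ρ t : π.H →L[ℂ] π.H) x)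
      ∂(normalizedHaar G) = (Module.finrank ℂ π.H : ℂ)⁻¹ * (inner ℂ w x * inner ℂ a b) := by
  obtain ⟨c, hc⟩ := exists_eq_smul_one π (average π π x w)
    (fun g => by ext b; exact average_ρ_apply π π x w b g)
  let e := stdOrthonormalBasis ℂ π.H
  -- Each averaged rank one operator has trace $\langle\pi(t)w,\pi(t)x\rangle=\langle w,x\rangle$,
  -- which determines the scalar.
  have htrace : (Module.finrank ℂ π.H : ℂ) * c = inner ℂ w x := by
    calc (Module.finrank ℂ π.H : ℂ) * c = ∑ i, inner ℂ (e i) (average π π x w (e i)) := by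
          simp [hc]
      _ = ∫ t, ∑ i, inner ℂ ((π.ρ t : π.H →L[ℂ] π.H) w) (e i) *
            inner ℂ (e i) ((π.ρ t : π.H →L[ℂ] π.H) x) ∂(normalizedHaar G) := by
          rw [integral_finsetSum]
          · exact Finset.sum_congr rfl fun i _ => inner_average ..
          · exact fun i _ => Continuous.integrable_normalizedHaar
              (((π.continuous_apply w).inner continuous_const).mul
                (continuous_const.inner (π.continuous_apply x)))
      _ = inner ℂ w x := by
          simp_rw [e.sum_inner_mul_inner, inner_ρ_ρ]
          simp
  rw [← inner_average, hc, ← htrace]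
  have : (Module.finrank ℂ π.H : ℂ) ≠ 0 := by
    exact_mod_cast Module.finrank_pos.ne'
  simp only [smul_apply, one_apply_eq_self, inner_smul_right]
  field_simp

theorem continuous_star_ρ :
    Continuous fun t : G => star (π.ρ t : π.H →L[ℂ] π.H) := by
  simp_rw [ContinuousLinearMap.star_eq_adjoint, adjoint_ρ]
  rw [continuous_clm_apply]
  exact fun x => (π.continuous_apply x).comp continuous_inv

end UnitaryIrrep

/-! ### Matrix coefficients and Bessel's inequality -/

section Bessel

variable {G : Type u} [Group G] [TopologicalSpace G] [IsTopologicalGroup G]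
  [CompactSpace G] [MeasurableSpace G] [BorelSpace G]

theorem MeasureTheory.Integrable.smul_star_ρ {f : G → ℂ} (hf : Integrable f (normalizedHaar G))
    (π : UnitaryIrrep.{u, v} G) :
    Integrable (fun t => f t • star (π.ρ t : π.H →L[ℂ] π.H)) (normalizedHaar G) := by
  refine hf.mono (hf.1.smul π.continuous_star_ρ.integrable_normalizedHaar.1) ?_
  refine Filter.Eventually.of_forall fun t => ?_
  rw [norm_smul, norm_star]
  exact mul_le_of_le_one_right (norm_nonneg _) (π.norm_ρ_le t)

theorem inner_fourierTransform {f : G → ℂ} (hf : Integrable f (normalizedHaar G))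
    (π : UnitaryDual.{u, v} G) (x y : π.space) :
    inner ℂ x (fourierTransform f π y) =
      ∫ t, f t * inner ℂ ((π.rep.ρ t : π.space →L[ℂ] π.space) x) y ∂(normalizedHaar G) := by
  have hi := hf.smul_star_ρ π.rep
  rw [fourierTransform, ContinuousLinearMap.integral_apply hi,
    ← integral_inner (hi.apply_continuousLinearMap y)]
  simp [inner_smul_right, ContinuousLinearMap.star_eq_adjoint,
    ContinuousLinearMap.adjoint_inner_right]

theorem norm_fourierTransform_le {f : G → ℂ} (hf : Integrable f (normalizedHaar G))
    (π : UnitaryDual.{u, v} G) :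
    ‖fourierTransform f π‖ ≤ ∫ t, ‖f t‖ ∂(normalizedHaar G) := by
  refine (norm_integral_le_integral_norm _).trans ?_
  refine integral_mono_of_nonneg (Filter.Eventually.of_forall fun t => norm_nonneg _) hf.norm
    (Filter.Eventually.of_forall fun t => ?_)
  simp only [norm_smul, norm_star]
  exact mul_le_of_le_one_right (norm_nonneg _) (π.rep.norm_ρ_le t)

theorem UnitaryDual.dim_pos (π : UnitaryDual.{u, v} G) : 0 < π.dim := Module.finrank_pos

/-- The normalized matrix coefficient `t ↦ √d_π ⟪a, π(t) b⟫`. -/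
noncomputable def matrixCoeff (π : UnitaryDual.{u, v} G) (a b : π.space) : C(G, ℂ) where
  toFun t := (Real.sqrt π.dim : ℂ) * inner ℂ a ((π.rep.ρ t : π.space →L[ℂ] π.space) b)
  continuous_toFun := continuous_const.mul (continuous_const.inner (π.rep.continuous_apply _))

/-- The normalized matrix coefficients of pairwise inequivalent irreducible representations
are orthonormal. -/
theorem orthonormal_matrixCoeff
    (e : ∀ π : UnitaryDual.{u, v} G, OrthonormalBasis (Fin π.dim) ℂ π.space) :
    Orthonormal ℂ fun j : Σ π : UnitaryDual.{u, v} G, Fin π.dim × Fin π.dim =>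
      ContinuousMap.toLp 2 (normalizedHaar G) ℂ
        (matrixCoeff j.1 (e j.1 j.2.1) (e j.1 j.2.2)) := by
  classical
  rw [orthonormal_iff_ite]
  rintro ⟨π, i, j⟩ ⟨σ, k, l⟩
  rw [ContinuousMap.inner_toLp]
  have key : ∀ t : G, ((Real.sqrt σ.dim : ℂ) * inner ℂ (e σ k)
      ((σ.rep.ρ t : σ.space →L[ℂ] σ.space) (e σ l))) * (starRingEnd ℂ) ((Real.sqrt π.dim : ℂ) *
        inner ℂ (e π i) ((π.rep.ρ t : π.space →L[ℂ] π.space) (e π j))) =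
      ((Real.sqrt π.dim : ℂ) * Real.sqrt σ.dim) *
        (inner ℂ ((π.rep.ρ t : π.space →L[ℂ] π.space) (e π j)) (e π i) *
        inner ℂ (e σ k) ((σ.rep.ρ t : σ.space →L[ℂ] σ.space) (e σ l))) := by
    intro t
    rw [map_mul, inner_conj_symm, Complex.conj_ofReal]
    ring
  simp only [matrixCoeff, ContinuousMap.coe_mk]
  simp_rw [key]
  rw [integral_const_mul]
  by_cases hπσ : π = σ
  · subst hπσ
    rw [UnitaryIrrep.integral_matrixCoeff]
    have hd : (π.dim : ℂ) ≠ 0 := by exact_mod_cast π.dim_pos.ne'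
    have hs : (Real.sqrt π.dim : ℂ) * Real.sqrt π.dim = π.dim := by
      rw [← Complex.ofReal_mul, Real.mul_self_sqrt (Nat.cast_nonneg _)]
      simp
    have hs' : (Module.finrank ℂ π.rep.H : ℂ) = π.dim := rfl
    rw [hs, hs', mul_inv_cancel_left₀ hd, orthonormal_iff_ite.1 (e π).orthonormal,
      orthonormal_iff_ite.1 (e π).orthonormal]
    by_cases hi : i = k <;> by_cases hj : j = l <;> simp [hi, hj, eq_comm]
  · rw [UnitaryIrrep.integral_matrixCoeff_eq_zero, mul_zero, if_neg]
    · exact fun h => hπσ (congrArg Sigma.fst h)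
    · intro h
      exact hπσ (by rw [← Quotient.out_eq π, ← Quotient.out_eq σ]; exact Quotient.sound h)

/-- **Bessel's inequality** for the Fourier transform on a compact group. -/
theorem sum_dim_mul_norm_fourierTransform_sq_le
    (e : ∀ π : UnitaryDual.{u, v} G, OrthonormalBasis (Fin π.dim) ℂ π.space)
    (F : Finset (UnitaryDual.{u, v} G)) {f : G → ℂ} (hf : MemLp f 2 (normalizedHaar G)) :
    ∑ π ∈ F, (π.dim : ℝ) * ∑ i, ‖fourierTransform f π (e π i)‖ ^ 2 ≤
      ∫ t, ‖f t‖ ^ 2 ∂(normalizedHaar G) := by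
  classical
  have hb := (orthonormal_matrixCoeff e).sum_inner_products_le (x := hf.toLp f)
    (s := F.sigma fun _ => Finset.univ)
  have hfi : Integrable f (normalizedHaar G) := hf.integrable one_le_two
  have hcoef : ∀ (π : UnitaryDual.{u, v} G) (j : Fin π.dim × Fin π.dim),
      ‖inner ℂ (ContinuousMap.toLp 2 (normalizedHaar G) ℂ (matrixCoeff π (e π j.1) (e π j.2)))
        (hf.toLp f)‖ ^ 2 = π.dim * ‖inner ℂ (e π j.2) (fourierTransform f π (e π j.1))‖ ^ 2 := by
    intro π j
    have : inner ℂ (ContinuousMap.toLp 2 (normalizedHaar G) ℂ (matrixCoeff π (e π j.1) (e π j.2)))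
        (hf.toLp f) = (Real.sqrt π.dim : ℂ) *
          inner ℂ (e π j.2) (fourierTransform f π (e π j.1)) := by
      rw [inner_fourierTransform hfi, L2.inner_def, ← integral_const_mul]
      apply integral_congr_ae
      filter_upwards [ContinuousMap.coeFn_toLp (p := 2) (𝕜 := ℂ) (normalizedHaar G)
        (matrixCoeff π (e π j.1) (e π j.2)),
        hf.coeFn_toLp] with t h1 h2
      rw [h1, h2, RCLike.inner_apply]
      simp only [matrixCoeff, ContinuousMap.coe_mk]
      rw [map_mul, inner_conj_symm, Complex.conj_ofReal]
      ring
    rw [this, norm_mul, mul_pow, Complex.norm_real, Real.norm_eq_abs, sq_abs,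
      Real.sq_sqrt (Nat.cast_nonneg _)]
  rw [Finset.sum_sigma] at hb
  simp_rw [hcoef] at hb
  have hnorm : ‖hf.toLp f‖ ^ 2 = ∫ t, ‖f t‖ ^ 2 ∂(normalizedHaar G) := by
    rw [Lp.norm_toLp, hf.eLpNorm_eq_integral_rpow_norm two_ne_zero ENNReal.ofNat_ne_top,
      ENNReal.toReal_ofReal (by positivity), ← Real.rpow_natCast, ← Real.rpow_mul (by positivity)]
    simp
  rw [hnorm] at hb
  refine le_trans (le_of_eq ?_) hb
  refine Finset.sum_congr rfl fun π _ => ?_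
  rw [Fintype.sum_prod_type, Finset.mul_sum]
  refine Finset.sum_congr rfl fun i _ => ?_
  dsimp only
  rw [← Finset.mul_sum, (e π).sum_sq_norm_inner_right]

end Bessel

/-! ### Marcinkiewicz interpolation -/

theorem lintegral_Ioi_indicator_rpow {r : ℝ} (hr : 0 < r) {a : ℝ} (ha : 0 ≤ a) :
    ∫⁻ x in Set.Ioi (0 : ℝ), (Set.Iio a).indicator (fun x => ENNReal.ofReal (x ^ (r - 1))) x =
      ENNReal.ofReal (a ^ r / r) := by
  rw [lintegral_indicator measurableSet_Iio, Measure.restrict_restrict measurableSet_Iio,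
    Set.inter_comm, Set.Ioi_inter_Iio, Measure.restrict_congr_set Ioo_ae_eq_Ioc,
    ← ofReal_integral_eq_lintegral_ofReal]
  · rw [← intervalIntegral.integral_of_le ha, integral_rpow (Or.inl (by linarith))]
    simp [Real.zero_rpow hr.ne']
  · exact (intervalIntegrable_iff_integrableOn_Ioc_of_le ha).1
      (intervalIntegral.intervalIntegrable_rpow' (by linarith))
  · filter_upwards [ae_restrict_mem measurableSet_Ioc] with x hx
    exact Real.rpow_nonneg hx.1.le _

section Interpolation

variable {X J : Type*} [MeasurableSpace X] {μ : Measure X} [IsFiniteMeasure μ]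

/-- Interpolation at a fixed height between the bounds `L¹ → ℓ^∞` and `L² → ℓ²`. -/
theorem sum_indicator_sq_le_of_truncation (s : Finset J) (w : J → ℝ) (hw : ∀ j ∈ s, 0 ≤ w j)
    (T : (X → ℂ) → J → ℂ)
    (hadd : ∀ g h, Integrable g μ → Integrable h μ → ∀ j ∈ s, T (g + h) j = T g j + T h j)
    (hone : ∀ g, Integrable g μ → ∀ j ∈ s, ‖T g j‖ ≤ ∫ x, ‖g x‖ ∂μ)
    (htwo : ∀ g, MemLp g 2 μ → ∑ j ∈ s, w j * ‖T g j‖ ^ 2 ≤ ∫ x, ‖g x‖ ^ 2 ∂μ)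
    {p : ℝ} (hp : 1 < p) {f : X → ℂ} (hfm : Measurable f) (hf : Integrable f μ)
    (hfp : Integrable (fun x => ‖f x‖ ^ p) μ) {M : ℝ} (hM : M = ∫ x, ‖f x‖ ^ p ∂μ) (hM0 : 0 < M)
    {l : ℝ} (hl : 0 < l) :
    ∑ j ∈ s, ENNReal.ofReal (w j * ‖T f j‖ ^ 2) * (Set.Iio ‖T f j‖).indicator 1 l ≤
      4 * ∫⁻ x, {x | l * ‖f x‖ ^ (p - 1) < 2 * M}.indicator
        (fun x => ENNReal.ofReal (‖f x‖ ^ 2)) x ∂μ := by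
  classical
  -- The cut-off is chosen so that off $A$ one has $|f|\le\frac{l}{2M}|f|^p$; the tail then has
  -- $L^1$ norm at most $l/2$.
  set A : Set X := {x | l * ‖f x‖ ^ (p - 1) < 2 * M} with hA
  have hAm : MeasurableSet A :=
    measurableSet_lt ((hfm.norm.pow_const _).const_mul _) measurable_const
  have hsplit : A.indicator f + Aᶜ.indicator f = f := Set.indicator_self_add_compl A f
  have hsmall : ∫ x, ‖Aᶜ.indicator f x‖ ∂μ ≤ l / 2 := by
    calc ∫ x, ‖Aᶜ.indicator f x‖ ∂μ ≤ ∫ x, l / (2 * M) * ‖f x‖ ^ p ∂μ := by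
          refine integral_mono (hf.indicator hAm.compl).norm (hfp.const_mul _) fun x => ?_
          by_cases hx : x ∈ A
          · simp only [Set.indicator_of_notMem (Set.notMem_compl_iff.2 hx), norm_zero]
            positivity
          · simp only [Set.indicator_of_mem (Set.mem_compl hx)]
            have hx' : 2 * M ≤ l * ‖f x‖ ^ (p - 1) := not_lt.1 hx
            have hfx : 0 < ‖f x‖ := by
              rw [norm_pos_iff]
              rintro h0
              rw [h0, norm_zero, Real.zero_rpow (by linarith)] at hx'
              linarith
            have h2 : ‖f x‖ ^ p = ‖f x‖ * ‖f x‖ ^ (p - 1) := by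
              rw [Real.rpow_sub_one hfx.ne']; field_simp
            rw [h2, div_mul_eq_mul_div, le_div_iff₀ (by positivity)]
            nlinarith
      _ = l / 2 := by
          rw [integral_const_mul, ← hM]; field_simp
  have hmem : MemLp (A.indicator f) 2 μ := by
    refine MemLp.of_bound (hfm.indicator hAm).aestronglyMeasurable ((2 * M / l) ^ (p - 1)⁻¹)
      (Filter.Eventually.of_forall fun x => ?_)
    by_cases hx : x ∈ A
    · rw [Set.indicator_of_mem hx]
      have hx' : l * ‖f x‖ ^ (p - 1) < 2 * M := hx
      have h1 : ‖f x‖ ^ (p - 1) ≤ 2 * M / l := by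
        rw [le_div_iff₀ hl]; linarith
      have h2 := Real.rpow_le_rpow (by positivity) h1 (inv_nonneg.2 (by linarith : 0 ≤ p - 1))
      rwa [Real.rpow_rpow_inv (norm_nonneg _) (by linarith)] at h2
    · rw [Set.indicator_of_notMem hx, norm_zero]
      positivity
  have hterm : ∀ j ∈ s, ENNReal.ofReal (w j * ‖T f j‖ ^ 2) * (Set.Iio ‖T f j‖).indicator 1 l ≤
      ENNReal.ofReal (4 * (w j * ‖T (A.indicator f) j‖ ^ 2)) := by
    intro j hj
    by_cases hlj : l < ‖T f j‖
    · rw [Set.indicator_of_mem (Set.mem_Iio.2 hlj), Pi.one_apply, mul_one]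
      apply ENNReal.ofReal_le_ofReal
      have h1 := hadd _ _ (hf.indicator hAm) (hf.indicator hAm.compl) j hj
      rw [hsplit] at h1
      have h2 := (hone _ (hf.indicator hAm.compl) j hj).trans hsmall
      have h3 := norm_add_le (T (A.indicator f) j) (T (Aᶜ.indicator f) j)
      rw [← h1] at h3
      -- The tail contributes at most $l/2<\|Tf_j\|/2$, so the truncated part carries at least half.
      have h4 : ‖T f j‖ ≤ 2 * ‖T (A.indicator f) j‖ := by linarith
      have h5 : ‖T f j‖ ^ 2 ≤ 4 * ‖T (A.indicator f) j‖ ^ 2 := by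
        nlinarith [norm_nonneg (T f j)]
      nlinarith [hw j hj]
    · rw [Set.indicator_of_notMem (by simpa using hlj), mul_zero]
      exact zero_le
  calc _ ≤ ∑ j ∈ s, ENNReal.ofReal (4 * (w j * ‖T (A.indicator f) j‖ ^ 2)) :=
        Finset.sum_le_sum hterm
    _ = ENNReal.ofReal (4 * ∑ j ∈ s, w j * ‖T (A.indicator f) j‖ ^ 2) := by
        rw [Finset.mul_sum, ENNReal.ofReal_sum_of_nonneg]
        exact fun j hj => mul_nonneg (by norm_num) (mul_nonneg (hw j hj) (by positivity))
    _ ≤ ENNReal.ofReal (4 * ∫ x, ‖A.indicator f x‖ ^ 2 ∂μ) :=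
        ENNReal.ofReal_le_ofReal (mul_le_mul_of_nonneg_left (htwo _ hmem) (by norm_num))
    _ = _ := by
        rw [ENNReal.ofReal_mul (by norm_num), ofReal_integral_eq_lintegral_ofReal
          (hmem.integrable_norm_pow two_ne_zero)
          (Filter.Eventually.of_forall fun x => by positivity)]
        congr 1
        · simp
        · congr 1
          ext x
          by_cases hx : x ∈ A <;> simp [hx]

/-- **Marcinkiewicz interpolation** between the bounds `L¹ → ℓ^∞` and `L² → ℓ²`. -/
theorem sum_mul_norm_rpow_le_of_interpolation (s : Finset J) (w : J → ℝ)
    (hw : ∀ j ∈ s, 0 ≤ w j) (T : (X → ℂ) → J → ℂ)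
    (hadd : ∀ g h, Integrable g μ → Integrable h μ → ∀ j ∈ s, T (g + h) j = T g j + T h j)
    (hone : ∀ g, Integrable g μ → ∀ j ∈ s, ‖T g j‖ ≤ ∫ x, ‖g x‖ ∂μ)
    (htwo : ∀ g, MemLp g 2 μ → ∑ j ∈ s, w j * ‖T g j‖ ^ 2 ≤ ∫ x, ‖g x‖ ^ 2 ∂μ)
    {p q : ℝ} (hpq : p.HolderConjugate q) (hp2 : p < 2) {f : X → ℂ} (hfm : Measurable f)
    (hf : Integrable f μ) (hfp : Integrable (fun x => ‖f x‖ ^ p) μ) :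
    ∑ j ∈ s, w j * ‖T f j‖ ^ q ≤ 2 ^ q * (∫ x, ‖f x‖ ^ p ∂μ) ^ (q - 1) := by
  have hp1 : 1 < p := hpq.lt
  have hmul : p * q = p + q := hpq.mul_eq_add
  have hq2 : 2 < q := by nlinarith
  obtain ⟨M, hM⟩ : ∃ M, M = ∫ x, ‖f x‖ ^ p ∂μ := ⟨_, rfl⟩
  have hM0 : 0 ≤ M := hM ▸ integral_nonneg fun x => by positivity
  rw [← hM]
  -- The truncation height needs $M>0$; for $M=0$ the function vanishes almost everywhere.
  rcases hM0.eq_or_lt with h0 | hMpos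
  · have hae : ∀ᵐ x ∂μ, ‖f x‖ = 0 := by
      have := (integral_eq_zero_iff_of_nonneg (fun x => by positivity) hfp).1 (hM ▸ h0.symm)
      filter_upwards [this] with x hx
      exact (Real.rpow_eq_zero (norm_nonneg _) (by linarith)).1 hx
    have hT : ∀ j ∈ s, ‖T f j‖ = 0 := fun j hj =>
      le_antisymm ((hone f hf j hj).trans_eq (integral_eq_zero_of_ae hae)) (norm_nonneg _)
    rw [Finset.sum_eq_zero fun j hj => by
      rw [hT j hj, Real.zero_rpow (by linarith), mul_zero]]
    positivity
  -- The $L^2$ bound takes care of two powers of $\|Tf_j\|$; the layer-cake formula produces the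
  -- remaining $r$.
  set r := q - 2 with hr
  have hr0 : 0 < r := by linarith
  have hlayer : ∀ j ∈ s, ENNReal.ofReal (w j * ‖T f j‖ ^ q) = ENNReal.ofReal r *
      ∫⁻ l in Set.Ioi (0 : ℝ), ENNReal.ofReal (l ^ (r - 1)) *
        (ENNReal.ofReal (w j * ‖T f j‖ ^ 2) * (Set.Iio ‖T f j‖).indicator 1 l) := by
    intro j hj
    have h1 : ∀ l : ℝ, ENNReal.ofReal (l ^ (r - 1)) *
        (ENNReal.ofReal (w j * ‖T f j‖ ^ 2) * (Set.Iio ‖T f j‖).indicator 1 l) =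
        ENNReal.ofReal (w j * ‖T f j‖ ^ 2) *
          (Set.Iio ‖T f j‖).indicator (fun x => ENNReal.ofReal (x ^ (r - 1))) l := by
      intro l
      by_cases hl : l ∈ Set.Iio ‖T f j‖
      · rw [Set.indicator_of_mem hl, Set.indicator_of_mem hl, Pi.one_apply, mul_one, mul_comm]
      · rw [Set.indicator_of_notMem hl, Set.indicator_of_notMem hl, mul_zero, mul_zero]
    simp_rw [h1]
    rw [lintegral_const_mul', lintegral_Ioi_indicator_rpow hr0 (norm_nonneg _),
      ← ENNReal.ofReal_mul (mul_nonneg (hw j hj) (by positivity)), ← ENNReal.ofReal_mul hr0.le]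
    · congr 1
      have h2 : ‖T f j‖ ^ q = ‖T f j‖ ^ 2 * ‖T f j‖ ^ r := by
        rcases (norm_nonneg (T f j)).eq_or_lt with h | h
        · rw [← h, Real.zero_rpow (by linarith)]; simp
        · rw [← Real.rpow_natCast, ← Real.rpow_add h]
          congr 1
          simp [hr]
      rw [h2]
      field_simp
    · exact ENNReal.ofReal_ne_top
  -- Integrating in $l$ up to $2M/|f|^{p-1}$ leaves $|f|^{2-(p-1)(q-2)}$, and conjugacy makes this
  -- exponent equal to $p$.
  have hpt : ∀ x, ENNReal.ofReal r * ∫⁻ l in Set.Ioi (0 : ℝ), ENNReal.ofReal (l ^ (r - 1)) *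
      {x | l * ‖f x‖ ^ (p - 1) < 2 * M}.indicator (fun x => ENNReal.ofReal (‖f x‖ ^ 2)) x =
      ENNReal.ofReal ((2 * M) ^ r * ‖f x‖ ^ p) := by
    intro x
    rcases (norm_nonneg (f x)).eq_or_lt with h | h
    · have : ∀ l : ℝ, {x | l * ‖f x‖ ^ (p - 1) < 2 * M}.indicator
          (fun x => ENNReal.ofReal (‖f x‖ ^ 2)) x = 0 := by
        intro l
        by_cases hx : x ∈ {x | l * ‖f x‖ ^ (p - 1) < 2 * M}
        · rw [Set.indicator_of_mem hx, ← h]; simp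
        · rw [Set.indicator_of_notMem hx]
      simp_rw [this]
      rw [← h, Real.zero_rpow (by linarith)]
      simp
    · have hb : 0 < ‖f x‖ ^ (p - 1) := by positivity
      have : ∀ l : ℝ, ENNReal.ofReal (l ^ (r - 1)) * {x | l * ‖f x‖ ^ (p - 1) < 2 * M}.indicator
          (fun x => ENNReal.ofReal (‖f x‖ ^ 2)) x = ENNReal.ofReal (‖f x‖ ^ 2) *
          (Set.Iio (2 * M / ‖f x‖ ^ (p - 1))).indicator
            (fun x => ENNReal.ofReal (x ^ (r - 1))) l := by
        intro l
        by_cases hx : l * ‖f x‖ ^ (p - 1) < 2 * M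
        · rw [Set.indicator_of_mem (by exact hx),
            Set.indicator_of_mem (by rwa [Set.mem_Iio, lt_div_iff₀ hb]), mul_comm]
        · rw [Set.indicator_of_notMem (by exact hx),
            Set.indicator_of_notMem (by rwa [Set.mem_Iio, lt_div_iff₀ hb]), mul_zero, mul_zero]
      simp_rw [this]
      rw [lintegral_const_mul' _ _ ENNReal.ofReal_ne_top,
        lintegral_Ioi_indicator_rpow hr0 (by positivity),
        ← ENNReal.ofReal_mul (by positivity), ← ENNReal.ofReal_mul hr0.le]
      congr 1
      rw [Real.div_rpow (by positivity) hb.le, ← Real.rpow_mul h.le]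
      have h2 : ‖f x‖ ^ p * ‖f x‖ ^ ((p - 1) * r) = ‖f x‖ ^ 2 := by
        rw [← Real.rpow_natCast, ← Real.rpow_add h]
        congr 1
        push_cast
        rw [hr]
        linarith
      rw [← h2]
      field_simp
  have hmeas : Measurable (Function.uncurry fun (l : ℝ) (x : X) => ENNReal.ofReal (l ^ (r - 1)) *
      {x | l * ‖f x‖ ^ (p - 1) < 2 * M}.indicator (fun x => ENNReal.ofReal (‖f x‖ ^ 2)) x) := by
    have hset : MeasurableSet {z : ℝ × X | z.1 * ‖f z.2‖ ^ (p - 1) < 2 * M} :=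
      measurableSet_lt (measurable_fst.mul ((hfm.comp measurable_snd).norm.pow_const _))
        measurable_const
    exact (measurable_fst.pow_const _).ennreal_ofReal.mul
      ((((hfm.comp measurable_snd).norm.pow_const 2).ennreal_ofReal).indicator hset)
  have hmain : ENNReal.ofReal (∑ j ∈ s, w j * ‖T f j‖ ^ q) ≤
      ENNReal.ofReal (2 ^ q * M ^ (q - 1)) := by
    calc ENNReal.ofReal (∑ j ∈ s, w j * ‖T f j‖ ^ q)
        = ∑ j ∈ s, ENNReal.ofReal (w j * ‖T f j‖ ^ q) :=
          ENNReal.ofReal_sum_of_nonneg fun j hj => mul_nonneg (hw j hj) (by positivity)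
      _ = ENNReal.ofReal r * ∫⁻ l in Set.Ioi (0 : ℝ), ENNReal.ofReal (l ^ (r - 1)) *
          ∑ j ∈ s, ENNReal.ofReal (w j * ‖T f j‖ ^ 2) * (Set.Iio ‖T f j‖).indicator 1 l := by
          rw [Finset.sum_congr rfl hlayer, ← Finset.mul_sum, ← lintegral_finsetSum]
          · simp_rw [Finset.mul_sum]
          · intro j _
            exact ((measurable_id.pow_const _).ennreal_ofReal).mul
              ((measurable_one.indicator measurableSet_Iio).const_mul _)
      _ ≤ ENNReal.ofReal r * ∫⁻ l in Set.Ioi (0 : ℝ), 4 * ∫⁻ x, ENNReal.ofReal (l ^ (r - 1)) *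
          {x | l * ‖f x‖ ^ (p - 1) < 2 * M}.indicator
            (fun x => ENNReal.ofReal (‖f x‖ ^ 2)) x ∂μ := by
          refine mul_le_mul_right ?_ _
          refine setLIntegral_mono' measurableSet_Ioi fun l hl => ?_
          rw [lintegral_const_mul' _ _ ENNReal.ofReal_ne_top, mul_left_comm]
          gcongr
          exact sum_indicator_sq_le_of_truncation s w hw T hadd hone htwo hp1 hfm hf hfp hM hMpos hl
      _ = 4 * ∫⁻ x, ENNReal.ofReal ((2 * M) ^ r * ‖f x‖ ^ p) ∂μ := by
          rw [lintegral_const_mul' _ _ (by simp), mul_left_comm,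
            lintegral_lintegral_swap hmeas.aemeasurable, ← lintegral_const_mul' _ _ (by simp)]
          simp_rw [hpt]
      _ = ENNReal.ofReal (2 ^ q * M ^ (q - 1)) := by
          rw [← ofReal_integral_eq_lintegral_ofReal (hfp.const_mul _)
            (Filter.Eventually.of_forall fun x => by positivity), integral_const_mul, ← hM,
            show (4 : ℝ≥0∞) = ENNReal.ofReal 4 by simp, ← ENNReal.ofReal_mul (by norm_num)]
          congr 1
          rw [Real.mul_rpow (by norm_num) hM0, hr, Real.rpow_sub two_pos,
            show q - 1 = (q - 2) + 1 by ring, Real.rpow_add_one hMpos.ne']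
          norm_num
          ring
  exact (ENNReal.ofReal_le_ofReal_iff (by positivity)).1 hmain

end Interpolation

/-! ### Schatten norms in an eigenbasis -/

section Schatten

variable {H : Type v} [NormedAddCommGroup H] [InnerProductSpace ℂ H]

theorem finite_spectrum_real [FiniteDimensional ℂ H] (S : H →L[ℂ] H) : (spectrum ℝ S).Finite := by
  rw [← spectrum.preimage_algebraMap ℂ]
  refine Set.Finite.preimage (FaithfulSMul.algebraMap_injective ℝ ℂ).injOn ?_
  have := Module.End.finite_spectrum (S : H →ₗ[ℂ] H)
  rwa [← AlgEquiv.spectrum_eq (Module.End.toContinuousLinearMap (𝕜 := ℂ) H)] at this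

theorem aeval_apply_of_apply_eq_smul {S : H →L[ℂ] H} {x : H} {c : ℝ} (hx : S x = (c : ℂ) • x)
    (P : Polynomial ℝ) : Polynomial.aeval S P x = ((P.eval c : ℝ) : ℂ) • x := by
  induction P using Polynomial.induction_on' with
  | add P Q hP hQ => simp [hP, hQ, add_smul]
  | monomial n a =>
    have : ∀ n : ℕ, (S ^ n) x = ((c ^ n : ℝ) : ℂ) • x := by
      intro n
      induction n with
      | zero => simp
      | succ n ih =>
        rw [pow_succ', mul_apply_eq_comp, ih, map_smul, hx, smul_smul]
        push_cast
        ring_nf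
    simp only [Polynomial.aeval_monomial, Algebra.algebraMap_eq_smul_one, smul_mul_assoc, one_mul,
      smul_apply, this, Polynomial.eval_monomial, Complex.ofReal_mul, mul_smul, Complex.coe_smul]

/-- The spectrum is finite, so `f` may be replaced by a Lagrange interpolation polynomial. Adding
`c` to the nodes avoids having to show that it lies in the spectrum, which fails for $x=0$ in
general. -/
theorem cfc_apply_of_apply_eq_smul [FiniteDimensional ℂ H] [CompleteSpace H]
    {S : H →L[ℂ] H} (hS : IsSelfAdjoint S) {x : H} {c : ℝ} (hx : S x = (c : ℂ) • x) (f : ℝ → ℝ) :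
    cfc f S x = ((f c : ℝ) : ℂ) • x := by
  classical
  let s : Finset ℝ := insert c (finite_spectrum_real S).toFinset
  let P := Lagrange.interpolate s id f
  have hP : ∀ a ∈ s, P.eval a = f a := fun a ha =>
    Lagrange.eval_interpolate_at_node f Function.injective_id.injOn ha
  rw [cfc_congr (g := P.eval) (fun a ha => (hP a (by simp [s, ha])).symm), cfc_polynomial P S hS,
    aeval_apply_of_apply_eq_smul hx, hP c (by simp [s])]

theorem sum_re_inner_eq_re_trace {ι : Type*} [Fintype ι] (e : OrthonormalBasis ι ℂ H)
    (S : H →L[ℂ] H) : ∑ i, RCLike.re (inner ℂ (e i) (S (e i))) =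
      RCLike.re (LinearMap.trace ℂ H (S : H →ₗ[ℂ] H)) := by
  rw [LinearMap.trace_eq_sum_inner _ e, map_sum]
  rfl

/-- Frees `posTrace` from its chosen Hilbert basis, through basis independence of the trace. -/
theorem posTrace_eq_sum [FiniteDimensional ℂ H] [CompleteSpace H] {ι : Type*} [Fintype ι]
    (e : OrthonormalBasis ι ℂ H) {S : H →L[ℂ] H} (hS : 0 ≤ S) :
    posTrace S = ENNReal.ofReal (∑ i, RCLike.re (inner ℂ (e i) (S (e i)))) := by
  obtain ⟨b, hb⟩ := (exists_hilbertBasis ℂ H).choose_spec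
  have hfin : Finite (exists_hilbertBasis ℂ H).choose := b.orthonormal.linearIndependent.finite
  have := Fintype.ofFinite (exists_hilbertBasis ℂ H).choose
  have hpos := (ContinuousLinearMap.nonneg_iff_isPositive S).1 hS
  rw [posTrace, tsum_fintype, ← ENNReal.ofReal_sum_of_nonneg
    (fun x _ => hpos.re_inner_nonneg_right _)]
  congr 1
  rw [sum_re_inner_eq_re_trace e, ← sum_re_inner_eq_re_trace b.toOrthonormalBasis]
  simp [hb]

/-- In the eigenbasis `e` of `|T|` the trace of `|T|^r` is the sum of the `‖T (e i)‖ ^ r`. -/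
theorem exists_orthonormalBasis_posTrace_abs_rpow [FiniteDimensional ℂ H] [CompleteSpace H]
    (T : H →L[ℂ] H) :
    ∃ e : OrthonormalBasis (Fin (Module.finrank ℂ H)) ℂ H, ∀ r : ℝ,
      posTrace (CFC.abs T ^ r) = ENNReal.ofReal (∑ i, ‖T (e i)‖ ^ r) := by
  have habs : 0 ≤ CFC.abs T := CFC.abs_nonneg T
  have hpos := (ContinuousLinearMap.nonneg_iff_isPositive _).1 habs
  have hsym : ((CFC.abs T : H →L[ℂ] H) : H →ₗ[ℂ] H).IsSymmetric := hpos.isSymmetric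
  refine ⟨hsym.eigenvectorBasis rfl, fun r => ?_⟩
  set e := hsym.eigenvectorBasis rfl with he
  have heig : ∀ i, CFC.abs T (e i) = (hsym.eigenvalues rfl i : ℂ) • e i :=
    fun i => hsym.apply_eigenvectorBasis rfl i
  have hnn : ∀ i, 0 ≤ hsym.eigenvalues rfl i := fun i => by
    have h1 := hpos.re_inner_nonneg_right (e i)
    rw [heig i, inner_smul_right, inner_self_eq_norm_sq_to_K, e.orthonormal.1 i] at h1
    simpa using h1
  -- From $T^*T=|T|^2$ it follows that $\|Te_i\|=\||T|e_i\|$.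
  have hnorm : ∀ i, ‖T (e i)‖ = hsym.eigenvalues rfl i := by
    intro i
    have h1 : inner ℂ (T (e i)) (T (e i)) = inner ℂ (CFC.abs T (e i)) (CFC.abs T (e i)) := by
      rw [← ContinuousLinearMap.adjoint_inner_right, ← ContinuousLinearMap.star_eq_adjoint,
        ← ContinuousLinearMap.adjoint_inner_right (CFC.abs T), hpos.isSelfAdjoint.adjoint_eq]
      have h2 := congrArg (fun S : H →L[ℂ] H => S (e i)) (CFC.abs_mul_abs T)
      simp only [mul_apply_eq_comp] at h2
      rw [h2]
    have h2 : ‖T (e i)‖ = ‖CFC.abs T (e i)‖ := by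
      rw [norm_eq_sqrt_re_inner (𝕜 := ℂ), h1, ← norm_eq_sqrt_re_inner (𝕜 := ℂ)]
    rw [h2, heig, norm_smul, e.orthonormal.1 i, mul_one, Complex.norm_real, Real.norm_eq_abs,
      abs_of_nonneg (hnn i)]
  rw [posTrace_eq_sum e CFC.rpow_nonneg, CFC.rpow_eq_cfc_real]
  congr 1
  refine Finset.sum_congr rfl fun i _ => ?_
  rw [cfc_apply_of_apply_eq_smul hpos.isSelfAdjoint (heig i), inner_smul_right,
    inner_self_eq_norm_sq_to_K, e.orthonormal.1 i, hnorm i]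
  simp

end Schatten

/-! ### Averages over a neighbourhood and Hausdorff–Young -/

section FourierAverages

variable {G : Type u} [Group G] [TopologicalSpace G] [IsTopologicalGroup G]
  [CompactSpace G] [MeasurableSpace G] [BorelSpace G]

/-- The operator norm is at most the Hilbert–Schmidt norm, by Cauchy–Schwarz. -/
theorem OrthonormalBasis.norm_apply_sq_le {H ι : Type*} [NormedAddCommGroup H]
    [InnerProductSpace ℂ H] [Fintype ι] (e : OrthonormalBasis ι ℂ H) (T : H →L[ℂ] H) (x : H) :
    ‖T x‖ ^ 2 ≤ (∑ i, ‖T (e i)‖ ^ 2) * ‖x‖ ^ 2 := by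
  have h1 : ‖T x‖ ≤ ∑ i, ‖inner ℂ (e i) x‖ * ‖T (e i)‖ := by
    conv_lhs => rw [← e.sum_repr' x, map_sum]
    refine (norm_sum_le _ _).trans (Finset.sum_le_sum fun i _ => ?_)
    rw [map_smul, norm_smul]
  calc ‖T x‖ ^ 2 ≤ (∑ i, ‖inner ℂ (e i) x‖ * ‖T (e i)‖) ^ 2 := by gcongr
    _ ≤ (∑ i, ‖inner ℂ (e i) x‖ ^ 2) * ∑ i, ‖T (e i)‖ ^ 2 := Finset.sum_mul_sq_le_sq_mul_sq ..
    _ = _ := by rw [e.sum_sq_norm_inner_right, mul_comm]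

/-- Outside a finite subset of the dual, the average of a representation over a fixed open set
has small diagonal coefficients. -/
theorem finite_setOf_not_average_le {O : Set G} (hO : IsOpen O) :
    {π : UnitaryDual.{u, v} G | ¬ ∀ x : π.space, ‖x‖ ≤ 1 →
      ‖∫ y, inner ℂ x ((π.rep.ρ y : π.space →L[ℂ] π.space) x)
        ∂(ProbabilityTheory.cond (normalizedHaar G) O)‖ ≤ 1 / 2}.Finite := by
  classical
  set c : ℝ := ((normalizedHaar G) O).toReal⁻¹ with hc
  let h : G → ℂ := O.indicator fun _ => (c : ℂ)
  have hm : MeasurableSet O := hO.measurableSet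
  have hh2 : MemLp h 2 (normalizedHaar G) := (memLp_const (c : ℂ)).indicator hm
  have hint : Integrable h (normalizedHaar G) := hh2.integrable one_le_two
  let e : ∀ π : UnitaryDual.{u, v} G, OrthonormalBasis (Fin π.dim) ℂ π.space :=
    fun π => stdOrthonormalBasis ℂ π.space
  -- `h` is the density of the conditional measure, so each exceptional $\pi$ contributes at least
  -- $(1/2)^2$ to the Bessel sum of `h`, using $d_\pi\ge1$. Hence there are at most $4\|h\|_2^2$ of
  -- them.
  have hbig : ∀ π : UnitaryDual.{u, v} G, (¬ ∀ x : π.space, ‖x‖ ≤ 1 →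
      ‖∫ y, inner ℂ x ((π.rep.ρ y : π.space →L[ℂ] π.space) x)
        ∂(ProbabilityTheory.cond (normalizedHaar G) O)‖ ≤ 1 / 2) →
      1 / 4 ≤ (π.dim : ℝ) * ∑ i, ‖fourierTransform h π (e π i)‖ ^ 2 := by
    intro π hπ
    push Not at hπ
    obtain ⟨x, hx, hlt⟩ := hπ
    have h1 : ∫ y, inner ℂ x ((π.rep.ρ y : π.space →L[ℂ] π.space) x)
        ∂(ProbabilityTheory.cond (normalizedHaar G) O) =
        starRingEnd ℂ (inner ℂ x (fourierTransform h π x)) := by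
      rw [inner_fourierTransform hint, ← integral_conj, ProbabilityTheory.cond,
        integral_smul_measure, ← integral_indicator hm, ENNReal.toReal_inv, ← hc,
        ← integral_smul]
      congr 1
      ext t
      by_cases ht : t ∈ O <;> simp [h, ht]
    rw [h1, RCLike.norm_conj] at hlt
    have h2 : ‖inner ℂ x (fourierTransform h π x)‖ ≤ ‖fourierTransform h π x‖ :=
      (norm_inner_le_norm _ _).trans (mul_le_of_le_one_left (norm_nonneg _) hx)
    have h3 := (e π).norm_apply_sq_le (fourierTransform h π) x
    have h4 : 0 ≤ ∑ i, ‖fourierTransform h π (e π i)‖ ^ 2 := by positivity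
    have h5 : (1 : ℝ) ≤ π.dim := by exact_mod_cast π.dim_pos
    have h6 : ‖x‖ ^ 2 ≤ 1 := pow_le_one₀ (norm_nonneg _) hx
    nlinarith
  by_contra hinf
  obtain ⟨n, hn⟩ := exists_nat_gt (4 * ∫ t, ‖h t‖ ^ 2 ∂(normalizedHaar G))
  obtain ⟨F, hFsub, hFcard⟩ := Set.Infinite.exists_subset_card_eq hinf n
  have hB := sum_dim_mul_norm_fourierTransform_sq_le e F hh2
  have hlow : (n : ℝ) * (1 / 4) ≤
      ∑ π ∈ F, (π.dim : ℝ) * ∑ i, ‖fourierTransform h π (e π i)‖ ^ 2 := by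
    rw [← hFcard, ← nsmul_eq_mul]
    exact Finset.card_nsmul_le_sum _ _ _ fun π hπ => hbig π (hFsub hπ)
  linarith

/-- A **Hausdorff–Young inequality** for diagonal coefficients of the Fourier transform. -/
theorem sum_dim_mul_norm_inner_fourierTransform_rpow_le
    (e : ∀ π : UnitaryDual.{u, v} G, OrthonormalBasis (Fin π.dim) ℂ π.space)
    (w : ∀ π : UnitaryDual.{u, v} G, Fin π.dim → π.space) (hw : ∀ π i, ‖w π i‖ ≤ 1)
    (F : Finset (UnitaryDual.{u, v} G)) {p : ℝ≥0∞} {q : ℝ} (hpq : p.toReal.HolderConjugate q)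
    (hp2 : p ≤ 2) {f : G → ℂ} (hfm : Measurable f) (hf : MemLp f p (normalizedHaar G)) :
    ∑ π ∈ F, (π.dim : ℝ) * ∑ i, ‖inner ℂ (w π i) (fourierTransform f π (e π i))‖ ^ q ≤
      (2 * (eLpNorm f p (normalizedHaar G)).toReal) ^ q := by
  classical
  have hptop : p ≠ ∞ := ne_top_of_le_ne_top ENNReal.ofNat_ne_top hp2
  have hp1 : 1 < p.toReal := hpq.lt
  have hp0 : p ≠ 0 := by rintro rfl; simp at hp1; linarith
  have hq1 : 1 < q := hpq.symm.lt
  have hnorm : (∫ t, ‖f t‖ ^ p.toReal ∂(normalizedHaar G)) ^ (q - 1) =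
      (eLpNorm f p (normalizedHaar G)).toReal ^ q := by
    rw [hf.eLpNorm_eq_integral_rpow_norm hp0 hptop, ENNReal.toReal_ofReal (by positivity),
      ← Real.rpow_mul (by positivity)]
    congr 1
    have := hpq.mul_eq_add
    field_simp
    linarith
  have hle1 : 1 ≤ p := by
    rw [← ENNReal.ofReal_toReal hptop, ← ENNReal.ofReal_one]
    exact ENNReal.ofReal_le_ofReal hp1.le
  have hfi : Integrable f (normalizedHaar G) := hf.integrable hle1
  have hfp : Integrable (fun t => ‖f t‖ ^ p.toReal) (normalizedHaar G) :=
    hf.integrable_norm_rpow hp0 hptop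
  have htwo : ∀ g, MemLp g 2 (normalizedHaar G) →
      ∑ π ∈ F, (π.dim : ℝ) * ∑ i, ‖inner ℂ (w π i) (fourierTransform g π (e π i))‖ ^ 2 ≤
      ∫ t, ‖g t‖ ^ 2 ∂(normalizedHaar G) := by
    intro g hg
    refine le_trans ?_ (sum_dim_mul_norm_fourierTransform_sq_le e F hg)
    gcongr with π _ i _
    exact (norm_inner_le_norm _ _).trans (mul_le_of_le_one_left (norm_nonneg _) (hw π i))
  rw [Real.mul_rpow two_pos.le ENNReal.toReal_nonneg, ← hnorm]
  -- At $p=2$ the layer-cake exponent $q-2$ degenerates, and Bessel's inequality applies directly.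
  rcases hp2.eq_or_lt with rfl | hlt
  · have hq : q = 2 := by
      have := hpq.mul_eq_add
      simp at this
      linarith
    subst hq
    have h1 := htwo f hf
    have h2 : 0 ≤ ∫ t, ‖f t‖ ^ 2 ∂(normalizedHaar G) := integral_nonneg fun t => by positivity
    norm_num
    simp only [ENNReal.toReal_ofNat, Real.rpow_two] at *
    linarith
  · have hlt' : p.toReal < 2 := by
      simpa using (ENNReal.toReal_lt_toReal hptop ENNReal.ofNat_ne_top).2 hlt
    have hI := sum_mul_norm_rpow_le_of_interpolation (μ := normalizedHaar G)
      (J := Σ π : UnitaryDual.{u, v} G, Fin π.dim) (F.sigma fun _ => Finset.univ)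
      (fun j => (j.1.dim : ℝ)) (fun _ _ => Nat.cast_nonneg _)
      (fun g j => inner ℂ (w j.1 j.2) (fourierTransform g j.1 (e j.1 j.2)))
      ?_ ?_ ?_ hpq hlt' hfm hfi hfp
    · rw [Finset.sum_sigma] at hI
      simpa only [Finset.mul_sum] using hI
    · intro g h hg hh j _
      have : fourierTransform (g + h) j.1 = fourierTransform g j.1 + fourierTransform h j.1 := by
        simp only [fourierTransform, Pi.add_apply, add_smul]
        exact integral_add (hg.smul_star_ρ _) (hh.smul_star_ρ _)
      rw [this, add_apply, inner_add_right]
    · intro g hg j _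
      refine le_trans ?_ (norm_fourierTransform_le hg j.1)
      refine (norm_inner_le_norm _ _).trans ?_
      refine (mul_le_of_le_one_left (norm_nonneg _) (hw j.1 j.2)).trans ?_
      refine (ContinuousLinearMap.le_opNorm _ _).trans ?_
      rw [(e j.1).orthonormal.1, mul_one]
    · intro g hg
      rw [Finset.sum_sigma]
      simpa only [Finset.mul_sum] using htwo g hg

/-- The Fourier transform of a translation difference `R_y f - f`. -/
theorem inner_fourierTransform_translate_sub {f : G → ℂ} (hf : Integrable f (normalizedHaar G))
    (y : G) (π : UnitaryDual.{u, v} G) (a x : π.space) :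
    inner ℂ a (fourierTransform (fun t => f (t * y) - f t) π x) =
      inner ℂ a ((π.rep.ρ y : π.space →L[ℂ] π.space) (fourierTransform f π x)) -
        inner ℂ a (fourierTransform f π x) := by
  have hfy : Integrable (fun t => f (t * y)) (normalizedHaar G) := hf.comp_mul_right y
  have hsub : fourierTransform (fun t => f (t * y) - f t) π =
      fourierTransform (fun t => f (t * y)) π - fourierTransform f π := by
    simp only [fourierTransform, sub_smul]
    exact integral_sub (hfy.smul_star_ρ _) (hf.smul_star_ρ _)
  rw [hsub, sub_apply, inner_sub_right]
  congr 1
  rw [← inv_inv y, ← UnitaryIrrep.inner_ρ_left, inner_fourierTransform hf, inv_inv,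
    inner_fourierTransform hfy, ← integral_mul_right_eq_self _ y⁻¹]
  congr 1
  ext t
  rw [inv_mul_cancel_right, UnitaryIrrep.ρ_mul_apply]

/-- Where the average of `π` over `O` is small, the Fourier transform of `f` is controlled by the
averages of the translation differences of `f` over `O`. -/
theorem norm_fourierTransform_apply_le_average {O : Set G} (hO : IsOpen O) (hO1 : O.Nonempty)
    {π : UnitaryDual.{u, v} G}
    (hπ : ∀ x : π.space, ‖x‖ ≤ 1 → ‖∫ y, inner ℂ x ((π.rep.ρ y : π.space →L[ℂ] π.space) x)
        ∂(ProbabilityTheory.cond (normalizedHaar G) O)‖ ≤ 1 / 2)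
    {f : G → ℂ} (hf : Integrable f (normalizedHaar G)) {a x : π.space} (ha : ‖a‖ ≤ 1)
    (hax : fourierTransform f π x = (‖fourierTransform f π x‖ : ℂ) • a) :
    ‖fourierTransform f π x‖ ≤
      2 * ‖∫ y, inner ℂ a (fourierTransform (fun t => f (t * y) - f t) π x)
        ∂(ProbabilityTheory.cond (normalizedHaar G) O)‖ := by
  have hpos : (normalizedHaar G) O ≠ 0 := (hO.measure_pos _ hO1).ne'
  have hprob : IsProbabilityMeasure (ProbabilityTheory.cond (normalizedHaar G) O) :=
    ProbabilityTheory.cond_isProbabilityMeasure hpos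
  set s := ‖fourierTransform f π x‖ with hs
  have hs0 : 0 ≤ s := norm_nonneg _
  -- If $s=0$ then `a` need not be a unit vector; the factor $s$ covers that case.
  have hsa : (s : ℂ) * inner ℂ a a = s := by
    rcases hs0.eq_or_lt with h | h
    · rw [← h]; simp
    · have h1 : s = s * ‖a‖ := by
        conv_lhs => rw [hs, hax, norm_smul, Complex.norm_real, Real.norm_eq_abs, abs_of_nonneg hs0]
      have h2 : ‖a‖ = 1 := by
        have := mul_left_cancel₀ h.ne' ((mul_one s).trans h1)
        exact this.symm
      rw [inner_self_eq_norm_sq_to_K, h2]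
      simp
  -- Averaged over $y$, the right-hand side becomes $s(\kappa-1)$ with $|\kappa|\le1/2$, of modulus
  -- at least $s/2$.
  have hz : ∀ y, inner ℂ a (fourierTransform (fun t => f (t * y) - f t) π x) =
      (s : ℂ) * inner ℂ a ((π.rep.ρ y : π.space →L[ℂ] π.space) a) - s := by
    intro y
    rw [inner_fourierTransform_translate_sub hf, hax, map_smul, inner_smul_right,
      inner_smul_right, hsa]
  have hint : Integrable (fun y => inner ℂ a ((π.rep.ρ y : π.space →L[ℂ] π.space) a))
      (ProbabilityTheory.cond (normalizedHaar G) O) :=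
    ((continuous_const.inner (π.rep.continuous_apply a)).integrable_of_hasCompactSupport
      (HasCompactSupport.of_compactSpace _))
  simp_rw [hz]
  rw [integral_sub (hint.const_mul _) (integrable_const _), integral_const_mul]
  simp only [integral_const, probReal_univ, one_smul]
  have h1 := hπ a ha
  set κ := ∫ y, inner ℂ a ((π.rep.ρ y : π.space →L[ℂ] π.space) a)
        ∂(ProbabilityTheory.cond (normalizedHaar G) O)
  have h2 : ‖(s : ℂ)‖ - ‖(s : ℂ) * κ‖ ≤ ‖(s : ℂ) * κ - s‖ := by
    rw [← norm_neg ((s : ℂ) * κ - s), neg_sub]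
    exact norm_sub_norm_le _ _
  rw [norm_mul, Complex.norm_real, Real.norm_eq_abs, abs_of_nonneg hs0] at h2
  nlinarith

end FourierAverages

/-- Reduces the norm to finite real sums in bases adapted to `φ`, an extended nonnegative series
being the supremum of its partial sums. -/
theorem dualNorm_le_ofReal {G : Type u} [Group G] [TopologicalSpace G]
    {q : ℝ≥0∞} (hq : q ≠ ∞) (hq0 : 0 < q.toReal) {Λ : Set (UnitaryDual.{u, v} G)}
    {φ : ∀ π : UnitaryDual.{u, v} G, π.space →L[ℂ] π.space}
    {e : ∀ π : UnitaryDual.{u, v} G, OrthonormalBasis (Fin π.dim) ℂ π.space}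
    (he : ∀ π, ∀ r : ℝ, posTrace (CFC.abs (φ π) ^ r) = ENNReal.ofReal (∑ i, ‖φ π (e π i)‖ ^ r))
    {C : ℝ} (hC : 0 ≤ C)
    (hF : ∀ F : Finset (UnitaryDual.{u, v} G), (∀ π ∈ F, π ∈ Λ) →
      ∑ π ∈ F, (π.dim : ℝ) * ∑ i, ‖φ π (e π i)‖ ^ q.toReal ≤ C ^ q.toReal) :
    dualNorm q Λ φ ≤ ENNReal.ofReal C := by
  classical
  have hterm : ∀ π : UnitaryDual.{u, v} G, (π.dim : ℝ≥0∞) * schattenNorm q (φ π) ^ q.toReal =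
      ENNReal.ofReal ((π.dim : ℝ) * ∑ i, ‖φ π (e π i)‖ ^ q.toReal) := by
    intro π
    rw [schattenNorm, if_neg hq, one_div, ENNReal.rpow_inv_rpow hq0.ne', he,
      ENNReal.ofReal_mul (Nat.cast_nonneg _), ENNReal.ofReal_natCast]
  rw [dualNorm, if_neg hq, one_div, ENNReal.rpow_inv_le_iff hq0,
    ENNReal.ofReal_rpow_of_nonneg hC hq0.le]
  simp_rw [hterm]
  rw [ENNReal.tsum_eq_iSup_sum]
  refine iSup_le fun F => ?_
  rw [← ENNReal.ofReal_sum_of_nonneg fun π _ => by positivity]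
  apply ENNReal.ofReal_le_ofReal
  have h1 := hF (F.map (Function.Embedding.subtype _)) (by simp +contextual)
  rwa [Finset.sum_map] at h1

/-! ### Uniform decay -/

section Decay

variable {G : Type u} [Group G] [TopologicalSpace G] [IsTopologicalGroup G]
  [CompactSpace G] [MeasurableSpace G] [BorelSpace G]

theorem exists_unit_direction {H : Type*} [NormedAddCommGroup H] [InnerProductSpace ℂ H] (x : H) :
    ∃ a : H, ‖a‖ ≤ 1 ∧ x = (‖x‖ : ℂ) • a ∧ inner ℂ a x = ‖x‖ := by
  rcases eq_or_ne x 0 with rfl | hx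
  · exact ⟨0, by simp, by simp, by simp⟩
  · have h : (‖x‖ : ℂ) ≠ 0 := by simpa using hx
    refine ⟨(‖x‖ : ℂ)⁻¹ • x, ?_, by rw [smul_inv_smul₀ h], ?_⟩
    · rw [norm_smul, norm_inv, Complex.norm_real, norm_norm, inv_mul_cancel₀ (by simpa using hx)]
    · rw [inner_smul_left, inner_self_eq_norm_sq_to_K, map_inv₀, Complex.conj_ofReal]
      simp only [Complex.coe_algebraMap]
      field_simp

/-- Jensen's inequality for $t\mapsto t^q$. -/
theorem norm_integral_rpow_le {X : Type*} [MeasurableSpace X] {ν : Measure X}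
    [IsProbabilityMeasure ν] {q : ℝ} (hq : 1 ≤ q) {z : X → ℂ} (hz : Integrable z ν)
    (hzq : Integrable (fun x => ‖z x‖ ^ q) ν) :
    ‖∫ x, z x ∂ν‖ ^ q ≤ ∫ x, ‖z x‖ ^ q ∂ν := by
  refine (Real.rpow_le_rpow (norm_nonneg _) (norm_integral_le_integral_norm z)
    (by linarith)).trans ?_
  exact (convexOn_rpow hq).map_integral_le
    (Real.continuous_rpow_const (by linarith)).continuousOn isClosed_Ici
    (Filter.Eventually.of_forall fun x => norm_nonneg _) hz.norm hzq

theorem memLp_translate_sub {p : ℝ≥0∞} {f : G → ℂ} (hf : MemLp f p (normalizedHaar G)) (y : G) :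
    MemLp (fun t => f (t * y) - f t) p (normalizedHaar G) :=
  (hf.comp_measurePreserving (measurePreserving_mul_right _ y)).sub hf

theorem continuous_inner_fourierTransform_translate_sub {f : G → ℂ}
    (hf : Integrable f (normalizedHaar G)) (π : UnitaryDual.{u, v} G) (a x : π.space) :
    Continuous fun y : G => inner ℂ a (fourierTransform (fun t => f (t * y) - f t) π x) := by
  simp_rw [inner_fourierTransform_translate_sub hf]
  exact (continuous_const.inner (π.rep.continuous_apply _)).sub continuous_const

/-- An `L¹`-equicontinuous set has uniformly decaying Fourier transforms in the operator norm. -/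
theorem hasUniformDecay_top (K : Set (Lp ℂ 1 (normalizedHaar G)))
    (hK : UniformlyLpEquicontinuous K) : HasUniformDecay ∞ (fourierImage.{u, v} K) := by
  have hnorm : ∀ f : G → ℂ, Integrable f (normalizedHaar G) →
      ∫ t, ‖f t‖ ∂(normalizedHaar G) = (eLpNorm f 1 (normalizedHaar G)).toReal := by
    intro f hf
    rw [eLpNorm_one_eq_lintegral_enorm, integral_norm_eq_lintegral_enorm hf.1]
  constructor
  · rintro _ ⟨f, -, rfl⟩
    have hf : Integrable f (normalizedHaar G) := L1.integrable_coeFn f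
    rw [dualNorm, if_pos rfl]
    refine lt_of_le_of_lt (b := ENNReal.ofReal (∫ t, ‖f t‖ ∂(normalizedHaar G)))
      (iSup₂_le fun π _ => ?_) ENNReal.ofReal_lt_top
    rw [schattenNorm, if_pos rfl, ← ofReal_norm]
    exact ENNReal.ofReal_le_ofReal (norm_fourierTransform_le hf π)
  · intro ε hε
    -- Averaging costs a factor 2, which leaves $\varepsilon/2$ and hence a strict inequality for
    -- the supremum.
    obtain ⟨O, hO, hO1, hOK⟩ := hK (ε / 4) (by positivity)
    refine ⟨_, finite_setOf_not_average_le hO, ?_⟩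
    rintro _ ⟨f, hfK, rfl⟩
    have hf : Integrable f (normalizedHaar G) := L1.integrable_coeFn f
    have hpos : (normalizedHaar G) O ≠ 0 := (hO.measure_pos _ ⟨1, hO1⟩).ne'
    have hprob : IsProbabilityMeasure (ProbabilityTheory.cond (normalizedHaar G) O) :=
      ProbabilityTheory.cond_isProbabilityMeasure hpos
    rw [dualNorm, if_pos rfl]
    refine lt_of_le_of_lt (b := ENNReal.ofReal (ε / 2)) (iSup₂_le fun π hπ => ?_)
      ((ENNReal.ofReal_lt_ofReal_iff hε).2 (by linarith))
    rw [schattenNorm, if_pos rfl, ← ofReal_norm]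
    apply ENNReal.ofReal_le_ofReal
    refine ContinuousLinearMap.opNorm_le_bound _ (by positivity) fun x => ?_
    obtain ⟨a, ha, hax, -⟩ := exists_unit_direction (fourierTransform f π x)
    refine (norm_fourierTransform_apply_le_average hO ⟨1, hO1⟩ (not_not.1 hπ) hf ha hax).trans ?_
    have hbd : ‖∫ y, inner ℂ a (fourierTransform (fun t => f (t * y) - f t) π x)
        ∂(ProbabilityTheory.cond (normalizedHaar G) O)‖ ≤ ε / 4 * ‖x‖ := by
      have := norm_integral_le_of_norm_le_const (C := ε / 4 * ‖x‖)
        (μ := ProbabilityTheory.cond (normalizedHaar G) O)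
        (f := fun y => inner ℂ a (fourierTransform (fun t => f (t * y) - f t) π x)) ?_
      · simpa using this
      filter_upwards [ProbabilityTheory.ae_cond_mem hO.measurableSet] with y hy
      have hfy : Integrable (fun t => f (t * y) - f t) (normalizedHaar G) :=
        (hf.comp_mul_right y).sub hf
      calc _ ≤ ‖a‖ * ‖fourierTransform (fun t => f (t * y) - f t) π x‖ := norm_inner_le_norm _ _
        _ ≤ ‖fourierTransform (fun t => f (t * y) - f t) π x‖ :=
            mul_le_of_le_one_left (norm_nonneg _) ha
        _ ≤ ‖fourierTransform (fun t => f (t * y) - f t) π‖ * ‖x‖ :=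
            ContinuousLinearMap.le_opNorm _ _
        _ ≤ ε / 4 * ‖x‖ := by
            gcongr
            refine (norm_fourierTransform_le hfy π).trans ?_
            rw [hnorm _ hfy]
            exact ENNReal.toReal_le_of_le_ofReal (by positivity) (hOK f hfK y hy).le
    linarith

/-- An `Lᵖ`-equicontinuous set, `1 < p ≤ 2`, has uniformly decaying Fourier transforms. -/
theorem hasUniformDecay_of_ne_top {p q : ℝ≥0∞} (hp1 : 1 ≤ p) (hp2 : p ≤ 2) (hqtop : q ≠ ∞)
    (hpq : p.toReal.HolderConjugate q.toReal) (K : Set (Lp ℂ p (normalizedHaar G)))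
    (hK : UniformlyLpEquicontinuous K) : HasUniformDecay q (fourierImage.{u, v} K) := by
  have hq1 : 1 < q.toReal := hpq.symm.lt
  have hq0 : 0 < q.toReal := by linarith
  have hbasis : ∀ f : G → ℂ, ∃ e : ∀ π : UnitaryDual.{u, v} G,
      OrthonormalBasis (Fin π.dim) ℂ π.space, ∀ π, ∀ r : ℝ,
      posTrace (CFC.abs (fourierTransform f π) ^ r) =
        ENNReal.ofReal (∑ i, ‖fourierTransform f π (e π i)‖ ^ r) := by
    intro f
    choose e he using fun π : UnitaryDual.{u, v} G =>
      exists_orthonormalBasis_posTrace_abs_rpow (fourierTransform f π)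
    exact ⟨e, he⟩
  constructor
  · rintro _ ⟨f, -, rfl⟩
    obtain ⟨e, he⟩ := hbasis f
    choose a ha hax hinner using fun (π : UnitaryDual.{u, v} G) (i : Fin π.dim) =>
      exists_unit_direction (fourierTransform f π (e π i))
    refine lt_of_le_of_lt (dualNorm_le_ofReal hqtop hq0 he
      (C := 2 * (eLpNorm f p (normalizedHaar G)).toReal) (by positivity) fun F _ => ?_)
      ENNReal.ofReal_lt_top
    have h1 := sum_dim_mul_norm_inner_fourierTransform_rpow_le e a ha F hpq hp2
      (Lp.stronglyMeasurable f).measurable (Lp.memLp f)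
    simpa only [hinner, Complex.norm_real, norm_norm] using h1
  · intro ε hε
    -- One factor 2 is lost in averaging and one in Hausdorff–Young, which leaves $\varepsilon/2$.
    obtain ⟨O, hO, hO1, hOK⟩ := hK (ε / 8) (by positivity)
    refine ⟨_, finite_setOf_not_average_le hO, ?_⟩
    rintro _ ⟨f, hfK, rfl⟩
    have hfm : Measurable f := (Lp.stronglyMeasurable f).measurable
    have hfLp : MemLp f p (normalizedHaar G) := Lp.memLp f
    have hf : Integrable f (normalizedHaar G) := hfLp.integrable hp1
    have hpos : (normalizedHaar G) O ≠ 0 := (hO.measure_pos _ ⟨1, hO1⟩).ne'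
    set ν := ProbabilityTheory.cond (normalizedHaar G) O with hν
    have hprob : IsProbabilityMeasure ν := ProbabilityTheory.cond_isProbabilityMeasure hpos
    -- The basis `e` and the directions `a` come from `f` and stay fixed while $y$ varies. They are
    -- not adapted to $R_yf-f$, but Hausdorff–Young holds for any orthonormal bases and any vectors
    -- of norm at most 1.
    obtain ⟨e, he⟩ := hbasis f
    choose a ha hax hinner using fun (π : UnitaryDual.{u, v} G) (i : Fin π.dim) =>
      exists_unit_direction (fourierTransform f π (e π i))
    refine lt_of_le_of_lt (dualNorm_le_ofReal hqtop hq0 he (C := ε / 2) (by positivity)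
      fun F hF => ?_) ((ENNReal.ofReal_lt_ofReal_iff hε).2 (by linarith))
    let z : ∀ π : UnitaryDual.{u, v} G, Fin π.dim → G → ℂ := fun π i y =>
      inner ℂ (a π i) (fourierTransform (fun t => f (t * y) - f t) π (e π i))
    have hzc : ∀ π i, Continuous (z π i) := fun π i =>
      continuous_inner_fourierTransform_translate_sub hf π _ _
    have hzi : ∀ π i, Integrable (z π i) ν := fun π i =>
      (hzc π i).integrable_of_hasCompactSupport (HasCompactSupport.of_compactSpace _)
    have hzq : ∀ π i, Integrable (fun y => ‖z π i y‖ ^ q.toReal) ν := fun π i =>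
      ((hzc π i).norm.rpow_const fun _ => Or.inr hq0.le).integrable_of_hasCompactSupport
        (HasCompactSupport.of_compactSpace _)
    have hpt : ∀ π ∈ F, ∀ i, ‖fourierTransform f π (e π i)‖ ^ q.toReal ≤
        2 ^ q.toReal * ∫ y, ‖z π i y‖ ^ q.toReal ∂ν := by
      intro π hπ i
      have h1 := norm_fourierTransform_apply_le_average hO ⟨1, hO1⟩ (not_not.1 (hF π hπ)) hf
        (ha π i) (hax π i)
      refine (Real.rpow_le_rpow (norm_nonneg _) h1 hq0.le).trans ?_
      rw [Real.mul_rpow two_pos.le (norm_nonneg _)]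
      gcongr
      exact norm_integral_rpow_le hq1.le (hzi π i) (hzq π i)
    calc ∑ π ∈ F, (π.dim : ℝ) * ∑ i, ‖fourierTransform f π (e π i)‖ ^ q.toReal
        ≤ ∑ π ∈ F, (π.dim : ℝ) * ∑ i, 2 ^ q.toReal * ∫ y, ‖z π i y‖ ^ q.toReal ∂ν := by
          gcongr with π hπ i _
          exact hpt π hπ i
      _ = 2 ^ q.toReal *
          ∫ y, ∑ π ∈ F, (π.dim : ℝ) * ∑ i, ‖z π i y‖ ^ q.toReal ∂ν := by
          rw [integral_finsetSum _ fun π _ =>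
            (integrable_finsetSum _ fun i _ => hzq π i).const_mul _, Finset.mul_sum]
          refine Finset.sum_congr rfl fun π _ => ?_
          rw [integral_const_mul, integral_finsetSum _ fun i _ => hzq π i, ← Finset.mul_sum]
          ring
      _ ≤ 2 ^ q.toReal * ∫ _y, (2 * (ε / 8)) ^ q.toReal ∂ν := by
          refine mul_le_mul_of_nonneg_left ?_ (by positivity)
          refine integral_mono_ae (integrable_finsetSum _ fun π _ =>
            (integrable_finsetSum _ fun i _ => hzq π i).const_mul _) (integrable_const _) ?_
          -- The measure `ν` lives on $O$, where equicontinuity bounds $\|R_yf-f\|_p$.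
          filter_upwards [ProbabilityTheory.ae_cond_mem hO.measurableSet] with y hy
          refine (sum_dim_mul_norm_inner_fourierTransform_rpow_le e a ha F hpq hp2
            ((hfm.comp (measurable_mul_const y)).sub hfm) (memLp_translate_sub hfLp y)).trans ?_
          gcongr
          exact ENNReal.toReal_le_of_le_ofReal (by positivity) (hOK f hfK y hy).le
      _ = (ε / 2) ^ q.toReal := by
          rw [integral_const, probReal_univ, one_smul, ← Real.mul_rpow two_pos.le (by positivity)]
          congr 1
          ring

end Decay

theorem lemma3p1 {G : Type u} [Group G] [TopologicalSpace G] [IsTopologicalGroup G]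
    [CompactSpace G] [T2Space G] [MeasurableSpace G] [BorelSpace G]
    (p p' : ℝ≥0∞) (hp1 : 1 ≤ p) (hp2 : p ≤ 2) (hpp' : p.HolderConjugate p')
    (K : Set (Lp ℂ p (normalizedHaar G))) (hK : UniformlyLpEquicontinuous K) :
    HasUniformDecay p' (fourierImage.{u, v} K) := by
  rcases hp1.eq_or_lt with rfl | hlt
  · obtain rfl : p' = ∞ := (ENNReal.HolderConjugate.eq_top_iff_eq_one p' 1).2 rfl
    exact hasUniformDecay_top K hK
  · have hptop : p ≠ ∞ := ne_top_of_le_ne_top ENNReal.ofNat_ne_top hp2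
    have hqtop : p' ≠ ∞ := fun h =>
      hlt.ne' ((ENNReal.HolderConjugate.eq_top_iff_eq_one p' p).1 h)
    have hreal := ENNReal.HolderConjugate.toReal_of_ne_top hptop hqtop
    exact hasUniformDecay_of_ne_top hp1 hp2 hqtop hreal K hK
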